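/- Let $(K,v)$ be a non-trivially valued, algebraically closed field of characteristic $0$ with value group $\Gamma=v(K^\times)$ (written additively), and let $\mathcal L$ be a first-order language extending the language $\mathcal L_{div}=(+,-,\cdot,0,1,\mathrm{div})$ of valued fields, where $\mathrm{div}(x,y)$ means $v(x)\le v(y)$. Let $(K,\mathcal L)$ be an expansion of $(K,\mathcal L_{div})$; "definable" means $\mathcal L$-definable with parameters (interpretable, for functions on $\Gamma$). A ball is a closed ball $\{x: v(x-a)\ge\gamma\}$ with $a\in K$, $\gamma\in\Gamma\cup\{+\infty\}$, or an open ball $\{x: v(x-a)>\gamma\}$ with $a\in K$, $\gamma\in\Gamma\cup\{-\infty\}$. Assume that 1. $(K,\mathcal L)$ is $C$-minimal: in every $\mathcal L$-structure $K'$ elementarily equivalent to $K$, every definable subset of $K'$ is a Boolean combination of balls; 2. $(K,\mathcal L)$ is definably complete: every definable family of balls which is a chain under inclusion and whose radii tend to $+\infty$ has non-empty intersection; 3. every definable function $g\colon\Gamma\to\Gamma$ is eventually $\mathbb Q$-linear: there are $r\in\mathbb Q$ and $\alpha,\delta\in\Gamma$ with $g(\gamma)=r\gamma+\alpha$ for all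 $\gamma>\delta$. Let $X\subseteq K$ and let $f\colon X\to K$ be a definable function. For a non-isolated point $x$ of $X$ write $f'(x)=\lim_{y\to x,\,y\in X\setminus\{x\}}\frac{f(y)-f(x)}{y-x}$ when this limit exists in $K$ for the valuation topology, and let $D=\{x\in X: f'(x) \text{ exists and } f'(x)=0\}$. Then $D$ is definable, and $D$ is a disjoint union $D=F\cup E$ where $F$ is finite and $f|_E$ is locally constant, i.e. every $x\in E$ lies in an open ball contained in $E$ on which $f$ is constant. Moreover, $f$ is $C^1$ on a cofinite subset of $X$: there is a set $U\subseteq X$, open in $K$, such that $X\setminus U$ is finite, $f$ is differentiable at every point of $U$, and $f'\colon U\to K$ is continuous. -/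

import Mathlib

open FirstOrder.Language (Structure)

universe u₁ u₂ w w'

namespace CMin

/-! ### The language of valued fields and the structure of a valued field in it -/

/-- The only relation symbol of the language of valued fields is a binary symbol `div`. -/
inductive DivRel : ℕ → Type
  | div : DivRel 2

/-- The language of valued fields: the ring language `(+, -, ·, 0, 1)` together with `div`. -/
def Ldiv : FirstOrder.Language := ⟨fun n => FirstOrder.Language.ring.Functions n, DivRel⟩

/-- The `Ldiv`-structure of a valued field: `div(x, y)` means `v x ≤ v y`. -/
@[reducible] def ldivStructure {K : Type w} [Field K] {Γ : Type w'} [AddCommGroup Γ]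
    [LinearOrder Γ] [IsOrderedAddMonoid Γ] (v : AddValuation K (WithTop Γ)) : Ldiv.Structure K where
  funMap {n} (f : FirstOrder.ringFunc n) (x : Fin n → K) : K :=
    match n, f, x with
    | _, .add, x => x 0 + x 1
    | _, .mul, x => x 0 * x 1
    | _, .neg, x => - x 0
    | _, .zero, _ => 0
    | _, .one, _ => 1
  RelMap {n} (r : DivRel n) (x : Fin n → K) : Prop :=
    match n, r, x with
    | _, .div, x => v (x 0) ≤ v (x 1)

/-- The given `L`-structure on `K`, where `L` extends `Ldiv` through `φ`, is an expansion of the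
valued field `(K, v)`. -/
def Expands {L : FirstOrder.Language.{u₁, u₂}} (φ : FirstOrder.Language.LHom Ldiv L) {K : Type w} [Field K] [L.Structure K]
    {Γ : Type w'} [AddCommGroup Γ] [LinearOrder Γ] [IsOrderedAddMonoid Γ]
    (v : AddValuation K (WithTop Γ)) : Prop :=
  let _ : Ldiv.Structure K := ldivStructure v
  φ.IsExpansionOn K

/-! ### Balls in an `Ldiv`-structure, and C-minimality -/

/-- The element `0` of an `Ldiv`-structure. -/
def sZero (M : Type w) [Ldiv.Structure M] : M :=
  Structure.funMap (L := Ldiv) (n := 0) FirstOrder.ringFunc.zero ![]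

/-- The element `x - y = x + (-y)` of an `Ldiv`-structure. -/
def sSub {M : Type w} [Ldiv.Structure M] (x y : M) : M :=
  Structure.funMap (L := Ldiv) (n := 2) FirstOrder.ringFunc.add
    ![x, Structure.funMap (L := Ldiv) (n := 1) FirstOrder.ringFunc.neg ![y]]

/-- The relation `div(x, y)`, that is `v x ≤ v y`, of an `Ldiv`-structure. -/
def sDiv {M : Type w} [Ldiv.Structure M] (x y : M) : Prop :=
  Structure.RelMap (L := Ldiv) (n := 2) DivRel.div ![x, y]

/-- Balls in (the valued field given by) an `Ldiv`-structure: the closed balls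
`{x | v (x - a) ≥ v b}` (singletons for `b = 0`), the open balls `{x | v (x - a) > v b}` with
`b ≠ 0`, and the whole field (the open ball of radius `-∞`). -/
def IsBallStr {M : Type w} [Ldiv.Structure M] (S : Set M) : Prop :=
  (∃ a b : M, S = {x | sDiv b (sSub x a)}) ∨
  (∃ a b : M, b ≠ sZero M ∧ S = {x | ¬ sDiv (sSub x a) b}) ∨
  S = Set.univ

/-- The `L`-structure `K` is C-minimal: in every `L`-structure elementarily equivalent to it, every
set definable with parameters is a Boolean combination of balls. (By compactness and
Löwenheim-Skolem it makes no difference that the equivalent structures live in this universe.) -/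
def IsCMinimal {L : FirstOrder.Language.{u₁, u₂}} (φ : FirstOrder.Language.LHom Ldiv L) (K : Type w) [L.Structure K] : Prop :=
  ∀ (K' : Type (max u₁ u₂ w)) [L.Structure K'], L.ElementarilyEquivalent K K' →
    letI : Ldiv.Structure K' := φ.reduct K'
    ∀ X : Set K', (Set.univ : Set K').Definable₁ L X →
      X ∈ BooleanSubalgebra.closure {S : Set K' | IsBallStr S}

section Valued

variable {K : Type w} [Field K] {Γ : Type w'} [AddCommGroup Γ] [LinearOrder Γ]
  [IsOrderedAddMonoid Γ]

/-! ### Balls, open sets, continuity and derivatives in a valued field -/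

/-- The closed ball `B(a, γ)`, with `γ ∈ Γ ∪ {+∞}`. -/
def closedBall (v : AddValuation K (WithTop Γ)) (a : K) (γ : WithTop Γ) : Set K :=
  {x | γ ≤ v (x - a)}

/-- The open ball `B°(a, γ)`, with `γ ∈ Γ`. -/
def openBall (v : AddValuation K (WithTop Γ)) (a : K) (γ : Γ) : Set K :=
  {x | (γ : WithTop Γ) < v (x - a)}

/-- A ball is a closed ball or an open ball; the field itself is the open ball of radius `-∞`. -/
def IsBall (v : AddValuation K (WithTop Γ)) (S : Set K) : Prop :=
  (∃ (a : K) (γ : WithTop Γ), S = closedBall v a γ) ∨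
  (∃ (a : K) (γ : Γ), S = openBall v a γ) ∨
  S = Set.univ

/-- The two notions of ball agree on a valued field. -/
theorem isBallStr_iff (v : AddValuation K (WithTop Γ)) (hv : Function.Surjective v) (S : Set K) :
    @IsBallStr K (ldivStructure v) S ↔ IsBall v S := by
  let _ : Ldiv.Structure K := ldivStructure v
  have hz : sZero K = (0 : K) := rfl
  have hs : ∀ x y : K, sSub x y = x - y := fun x y => (sub_eq_add_neg x y).symm
  have hd : ∀ x y : K, sDiv x y ↔ v x ≤ v y := fun x y => Iff.rfl
  unfold IsBallStr IsBall closedBall openBall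
  simp only [hz, hs, hd, not_le]
  refine or_congr ?_ (or_congr ?_ Iff.rfl)
  · constructor
    · rintro ⟨a, b, h⟩
      exact ⟨a, v b, h⟩
    · rintro ⟨a, γ, h⟩
      obtain ⟨b, rfl⟩ := hv γ
      exact ⟨a, b, h⟩
  · constructor
    · rintro ⟨a, b, hb, h⟩
      obtain ⟨γ, hγ⟩ := WithTop.ne_top_iff_exists.mp ((AddValuation.ne_top_iff v).mpr hb)
      exact ⟨a, γ, by rw [hγ]; exact h⟩
    · rintro ⟨a, γ, h⟩
      obtain ⟨b, hb⟩ := hv γ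
      refine ⟨a, b, ?_, by rw [hb]; exact h⟩
      rintro rfl
      rw [AddValuation.map_zero] at hb
      exact WithTop.top_ne_coe hb

/-- `U` is open in the valuation topology. -/
def IsOpenV (v : AddValuation K (WithTop Γ)) (U : Set K) : Prop :=
  ∀ x ∈ U, ∃ γ : Γ, openBall v x γ ⊆ U

/-- `g` restricted to `U` is continuous for the valuation topology. -/
def ContinuousOnV (v : AddValuation K (WithTop Γ)) (g : K → K) (U : Set K) : Prop :=
  ∀ x ∈ U, ∀ γ : Γ, ∃ δ : Γ, ∀ y ∈ U, y ∈ openBall v x δ → g y ∈ openBall v (g x) γ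

/-- The function `f : X → K` has derivative `a` at `x`: the point `x` is not isolated in `X`, and
`(f y - f x) / (y - x)` tends to `a` as `y ∈ X`, `y ≠ x`, tends to `x`. -/
def HasDeriv (v : AddValuation K (WithTop Γ)) (X : Set K) (f : K → K) (x a : K) : Prop :=
  (∀ δ : Γ, ∃ y ∈ X, y ≠ x ∧ y ∈ openBall v x δ) ∧
  ∀ γ : Γ, ∃ δ : Γ, ∀ y ∈ X, y ≠ x → y ∈ openBall v x δ →
    (f y - f x) / (y - x) ∈ openBall v a γ

/-- The set `{x ∈ X | f'(x) = 0}`. -/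
def zeroDerivSet (v : AddValuation K (WithTop Γ)) (X : Set K) (f : K → K) : Set K :=
  {x | x ∈ X ∧ HasDeriv v X f x 0}

/-- `f` restricted to `E` is locally constant: every point of `E` has an open ball around it that
is contained in `E` and on which `f` is constant. -/
def LocallyConstantOn (v : AddValuation K (WithTop Γ)) (f : K → K) (E : Set K) : Prop :=
  ∀ x ∈ E, ∃ γ : Γ, openBall v x γ ⊆ E ∧ ∀ y ∈ openBall v x γ, f y = f x

/-- `f` is `C¹` on `U`: the set `U` is open, `f` is differentiable at every point of `U`, and its
derivative is continuous on `U`. -/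
def IsC1On (v : AddValuation K (WithTop Γ)) (f : K → K) (U : Set K) : Prop :=
  IsOpenV v U ∧
  ∃ f' : K → K, (∀ x ∈ U, HasDeriv v U f x (f' x)) ∧ ContinuousOnV v f' U

/-! ### Definable completeness, definable functions, functions on the value group -/

/-- The fibre over `p` of a family `S` of subsets of `K`, parametrized by `n`-tuples. -/
def fiber {n : ℕ} (S : Set (Fin n ⊕ Unit → K)) (p : Fin n → K) : Set K :=
  {x | Sum.elim p (fun _ => x) ∈ S}

/-- Definable completeness: every definable family of nested balls whose radii tend to `+∞` has
non-empty intersection. -/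
def DefinablyComplete (L : FirstOrder.Language.{u₁, u₂}) [L.Structure K]
    (v : AddValuation K (WithTop Γ)) : Prop :=
  ∀ (n : ℕ) (W : Set (Fin n → K)) (S : Set (Fin n ⊕ Unit → K)),
    (Set.univ : Set K).Definable L W → (Set.univ : Set K).Definable L S →
    (∀ p ∈ W, IsBall v (fiber S p)) →
    (∀ p ∈ W, ∀ q ∈ W, fiber S p ⊆ fiber S q ∨ fiber S q ⊆ fiber S p) →
    (∀ γ : Γ, ∃ p ∈ W, ∃ a : K, fiber S p ⊆ closedBall v a γ) →
    ∃ x : K, ∀ p ∈ W, x ∈ fiber S p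

/-- The function `f : X → K` (the values of `f` outside `X` are irrelevant) is definable with
parameters: its graph is. -/
def DefinableFun (L : FirstOrder.Language.{u₁, u₂}) [L.Structure K] (X : Set K) (f : K → K) : Prop :=
  (Set.univ : Set K).Definable₂ L {p : K × K | p.1 ∈ X ∧ p.2 = f p.1}

/-- The function `g : Γ → Γ` on the value group is definable (that is, interpretable) with
parameters: the preimage of its graph under `v × v` is definable. -/
def DefinableGammaFun (L : FirstOrder.Language.{u₁, u₂}) [L.Structure K] (v : AddValuation K (WithTop Γ))
    (g : Γ → Γ) : Prop :=
  (Set.univ : Set K).Definable₂ L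
    {p : K × K | ∃ γ : Γ, v p.1 = (γ : WithTop Γ) ∧ v p.2 = (g γ : WithTop Γ)}

/-- `g : Γ → Γ` is eventually `ℚ`-linear: there are `r = m / n ∈ ℚ` and `α, δ ∈ Γ` with
`g γ = r γ + α` for all `γ > δ`. In the torsion-free group `Γ` the element `r γ` is the one whose
`n`-th multiple is `m γ`. -/
def EventuallyQLinear (g : Γ → Γ) : Prop :=
  ∃ (m : ℤ) (n : ℕ) (α δ : Γ), 0 < n ∧ ∀ γ : Γ, δ < γ → n • (g γ - α) = m • γ

end Valued

end CMin

/-!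
The proof rests on two consequences of `C`-minimality. By `exists_determined_of_defPred`, the
members of a definable family of subsets of `K` are Boolean combinations of a bounded number of
balls; the bound comes from an ultrapower of `K`. Hence a definable set contains or avoids a
punctured neighbourhood of any given point, and all but finitely many of its points are interior.
By `TameExpansion.exists_generic_class`, a definable total preorder on `K` has in each closed ball
a class that contains all but finitely many residue classes of the ball, since Boolean
combinations of few balls cannot cut an ordering of the infinite residue field in the middle. It
is applied to preorders that compare thresholds: `x` precedes `y` if every radius that works for
`y` works for `x`.

Near `0`, a definable function to the value group factors through the valuation
(`TameExpansion.eventually_eq_of_val_eq`), so that eventual `ℚ`-linearity applies to it. With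
definable completeness it follows that a definable function `K → K` whose valuation is constant
near `0` has a limit at `0` (`TameExpansion.exists_limit`).

Suppose that `f` is nowhere locally constant on a ball. On a smaller ball, `v (f y - f x)` depends
only on `x` and `v (y - x)` (`TameExpansion.exists_scalesOn`), and near each point `x` it has the
form `r • v (y - x) + α` with `r` rational. Here `r` is a positive integer
(`TameExpansion.exists_dilation`): if `r = m / n`, the function `(f (x + t ^ n) - f x) / t ^ m`
has a nonzero limit at `t = 0`, and multiplying `t` by a primitive `n`-th root of unity, which
exists in characteristic `0`, shows that `n` divides `m`. The same holds for the inverse of `f` on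
a ball of the image, so `r = 1` at some point, and there the difference quotient has a nonzero
limit (`TameExpansion.exists_hasDerivAtV`). Consequently the definable set of points at which `f`
neither is locally constant nor has a nonzero derivative contains no ball and is finite
(`TameExpansion.finite_exceptional`). Both assertions on the zeros of `f'` and on the
differentiability of `f` follow, and the statement applied to `f'` itself gives its continuity off
a finite set.
-/

namespace CMin

/-! ### Definable predicates and functions -/

section Definability

variable (L : FirstOrder.Language.{u₁, u₂}) {K : Type w} [L.Structure K] {α β : Type}

/-- The predicate `P` on tuples is definable with parameters. Tuples are indexed by an arbitrary
type of variables; a quantifier is removed by passing from `α` to `Option α`. -/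
def DefPred (P : (α → K) → Prop) : Prop := (Set.univ : Set K).Definable L {x | P x}

/-- The function `g` of a tuple is definable with parameters. -/
abbrev DefFun (g : (α → K) → K) : Prop := (Set.univ : Set K).DefinableFun L g

variable {L}

theorem DefPred.congr {P Q : (α → K) → Prop} (h : DefPred L P) (hPQ : ∀ x, P x ↔ Q x) :
    DefPred L Q := by
  have : Q = P := funext fun x => propext (hPQ x).symm
  rwa [this]

theorem DefPred.and {P Q : (α → K) → Prop} (hP : DefPred L P) (hQ : DefPred L Q) :
    DefPred L (fun x => P x ∧ Q x) := hP.inter hQ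

theorem DefPred.or {P Q : (α → K) → Prop} (hP : DefPred L P) (hQ : DefPred L Q) :
    DefPred L (fun x => P x ∨ Q x) := hP.union hQ

theorem DefPred.not {P : (α → K) → Prop} (hP : DefPred L P) :
    DefPred L (fun x => ¬ P x) := hP.compl

theorem DefPred.imp {P Q : (α → K) → Prop} (hP : DefPred L P) (hQ : DefPred L Q) :
    DefPred L (fun x => P x → Q x) :=
  (hP.not.or hQ).congr fun _ => imp_iff_not_or.symm

theorem DefPred.ex {P : (α → K) → K → Prop}
    (h : DefPred L (fun x : Option α → K => P (fun i => x (some i)) (x none))) :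
    DefPred L (fun x => ∃ z, P x z) := by
  have h1 : (Set.univ : Set K).Definable L
      {x : α ⊕ Unit → K | P (fun i => x (Sum.inl i)) (x (Sum.inr ()))} := by
    have := Set.Definable.preimage_comp
      (fun o : Option α => (o.elim (Sum.inr ()) Sum.inl : α ⊕ Unit)) h
    exact this
  have h2 := Set.Definable.exists_of_finite h1
  refine DefPred.congr (P := _) h2 fun x => ?_
  constructor
  · rintro ⟨u, hu⟩
    exact ⟨u (), hu⟩
  · rintro ⟨z, hz⟩
    exact ⟨fun _ => z, hz⟩

theorem DefPred.all {P : (α → K) → K → Prop}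
    (h : DefPred L (fun x : Option α → K => P (fun i => x (some i)) (x none))) :
    DefPred L (fun x => ∀ z, P x z) :=
  (DefPred.ex (P := fun x z => ¬ P x z) h.not).not.congr fun _ => not_exists_not

theorem DefPred.subst [Finite β] {P : (β → K) → Prop} (hP : DefPred L P)
    {G : (α → K) → β → K} (hG : ∀ i, DefFun L (fun x => G x i)) :
    DefPred L (fun x => P (G x)) :=
  Set.Definable.preimage_map (F := G) hG hP

theorem DefFun.subst [Finite β] {g : (β → K) → K} (hg : DefFun L g)
    {G : (α → K) → β → K} (hG : ∀ i, DefFun L (fun x => G x i)) :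
    DefFun L (fun x => g (G x)) :=
  Set.DefinableFun.comp (g := G) hG hg

theorem DefFun.var (i : α) : DefFun L (fun x : α → K => x i) := Set.DefinableFun.proj L

theorem DefFun.const (a : K) : DefFun L (fun _ : α → K => a) :=
  FirstOrder.Language.definableFun_const _ _ (Set.mem_univ a)

theorem DefPred.eq {g h : (α → K) → K} (hg : DefFun L g) (hh : DefFun L h) :
    DefPred L (fun x => g x = h x) := Set.DefinableFun.ofPred_eq hg hh

theorem defFun_iff_graph {g : (α → K) → K} :
    DefFun L g ↔ DefPred L (fun x : Option α → K => g (fun i => x (some i)) = x none) :=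
  Iff.rfl

theorem DefPred.rel₁ {R : K → Prop} (hR : DefPred L (fun x : Fin 1 → K => R (x 0)))
    {g : (α → K) → K} (hg : DefFun L g) : DefPred L (fun x => R (g x)) :=
  DefPred.subst hR (G := fun x _ => g x) fun _ => hg

theorem DefPred.rel₂ {R : K → K → Prop} (hR : DefPred L (fun x : Fin 2 → K => R (x 0) (x 1)))
    {g h : (α → K) → K} (hg : DefFun L g) (hh : DefFun L h) :
    DefPred L (fun x => R (g x) (h x)) :=
  DefPred.subst hR (G := fun x => ![g x, h x]) fun i => by fin_cases i <;> assumption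

theorem DefFun.fn₁ {f : K → K} (hf : DefFun L (fun x : Fin 1 → K => f (x 0)))
    {g : (α → K) → K} (hg : DefFun L g) : DefFun L (fun x => f (g x)) :=
  DefFun.subst hf (G := fun x _ => g x) fun _ => hg

theorem DefFun.fn₂ {f : K → K → K} (hf : DefFun L (fun x : Fin 2 → K => f (x 0) (x 1)))
    {g h : (α → K) → K} (hg : DefFun L g) (hh : DefFun L h) :
    DefFun L (fun x => f (g x) (h x)) :=
  DefFun.subst hf (G := fun x => ![g x, h x]) fun i => by fin_cases i <;> assumption

end Definability

/-! ### Uniform finiteness of the number of balls -/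

section UniformFiniteness

/-- Membership in `S` depends only on the position of a point with respect to finitely many balls:
each pair `(a, b)` in the list stands for the closed and the open ball around `a` of radius `v b`.
Every Boolean combination of balls of an `Ldiv`-structure is of this form. -/
def DeterminedStr {M : Type w} [Ldiv.Structure M] (l : List (M × M)) (S : Set M) : Prop :=
  ∀ x y : M, (∀ p ∈ l, (sDiv p.2 (sSub x p.1) ↔ sDiv p.2 (sSub y p.1)) ∧
    (sDiv (sSub x p.1) p.2 ↔ sDiv (sSub y p.1) p.2)) → (x ∈ S ↔ y ∈ S)

theorem exists_determinedStr {M : Type w} [Ldiv.Structure M] {S : Set M}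
    (hS : S ∈ BooleanSubalgebra.closure {S : Set M | IsBallStr S}) :
    ∃ l : List (M × M), DeterminedStr l S := by
  induction hS using BooleanSubalgebra.closure_bot_sup_induction with
  | mem S hS =>
    rcases hS with ⟨a, b, rfl⟩ | ⟨a, b, -, rfl⟩ | rfl
    · exact ⟨[(a, b)], fun x y h => (h (a, b) (by simp)).1⟩
    · exact ⟨[(a, b)], fun x y h => not_congr (h (a, b) (by simp)).2⟩
    · exact ⟨[], fun x y _ => by simp⟩
  | bot => exact ⟨[], fun x y _ => by simp⟩
  | sup S hS T hT ihS ihT =>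
    obtain ⟨l, hl⟩ := ihS
    obtain ⟨m, hm⟩ := ihT
    refine ⟨l ++ m, fun x y h => ?_⟩
    have h1 := hl x y fun p hp => h p (by simp [hp])
    have h2 := hm x y fun p hp => h p (by simp [hp])
    change (x ∈ S ∨ x ∈ T) ↔ (y ∈ S ∨ y ∈ T)
    rw [h1, h2]
  | compl S hS ih =>
    obtain ⟨l, hl⟩ := ih
    exact ⟨l, fun x y h => not_congr (hl x y h)⟩

variable {K : Type w} [Field K] {Γ : Type w'} [AddCommGroup Γ] [LinearOrder Γ]
  [IsOrderedAddMonoid Γ]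

/-- Membership in `S` depends only on the position of a point with respect to finitely many balls:
each pair `(a, γ)` in the list stands for the closed and the open ball around `a` of radius `γ`. -/
def Determined (v : AddValuation K (WithTop Γ)) (l : List (K × WithTop Γ)) (S : Set K) : Prop :=
  ∀ x y : K, (∀ p ∈ l, (p.2 ≤ v (x - p.1) ↔ p.2 ≤ v (y - p.1)) ∧
    (p.2 < v (x - p.1) ↔ p.2 < v (y - p.1))) → (x ∈ S ↔ y ∈ S)

section Expands

variable {L : FirstOrder.Language.{u₁, u₂}} {φ : FirstOrder.Language.LHom Ldiv L}
  {v : AddValuation K (WithTop Γ)} [L.Structure K]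

theorem Expands.funMap_add (h : Expands φ v) (x : Fin 2 → K) :
    Structure.funMap (L := L) (φ.onFunction (n := 2) FirstOrder.ringFunc.add) x = x 0 + x 1 := by
  let _ : Ldiv.Structure K := ldivStructure v
  exact h.map_onFunction (n := 2) FirstOrder.ringFunc.add x

theorem Expands.funMap_mul (h : Expands φ v) (x : Fin 2 → K) :
    Structure.funMap (L := L) (φ.onFunction (n := 2) FirstOrder.ringFunc.mul) x = x 0 * x 1 := by
  let _ : Ldiv.Structure K := ldivStructure v
  exact h.map_onFunction (n := 2) FirstOrder.ringFunc.mul x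

theorem Expands.funMap_neg (h : Expands φ v) (x : Fin 1 → K) :
    Structure.funMap (L := L) (φ.onFunction (n := 1) FirstOrder.ringFunc.neg) x = - x 0 := by
  let _ : Ldiv.Structure K := ldivStructure v
  exact h.map_onFunction (n := 1) FirstOrder.ringFunc.neg x

theorem Expands.relMap_div (h : Expands φ v) (x : Fin 2 → K) :
    Structure.RelMap (L := L) (φ.onRelation (n := 2) DivRel.div) x ↔ v (x 0) ≤ v (x 1) := by
  let _ : Ldiv.Structure K := ldivStructure v
  exact Eq.to_iff (h.map_onRelation (n := 2) DivRel.div x)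

end Expands

open Filter in
/-- Uniform finiteness. If the fibres of a definable family needed arbitrarily many balls, then in
an ultrapower of `K` the fibre over the class of a sequence of ever worse parameters would be a
definable set that is not a Boolean combination of balls. -/
theorem exists_determined_of_defPred
    {L : FirstOrder.Language.{u₁, u₂}} (φ : FirstOrder.Language.LHom Ldiv L)
    (v : AddValuation K (WithTop Γ)) [L.Structure K] (hexp : Expands φ v) (hmin : IsCMinimal φ K)
    {α : Type} {P : (Option α → K) → Prop} (hP : DefPred L P) :
    ∃ N : ℕ, ∀ p : α → K, ∃ l : List (K × WithTop Γ), l.length ≤ N ∧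
      Determined v l {x | P (fun o => o.elim x p)} := by
  by_contra! hcon
  choose p hp using hcon
  -- the index set is lifted so that the ultrapower lies in the universe of `IsCMinimal`
  let ι : Type (max u₁ u₂) := ULift ℕ
  let U : Ultrafilter ι := hyperfilter ι
  let K' : Type (max u₁ u₂ w) := (U : Filter ι).Product (fun _ : ι => K)
  let mk : (ι → K) → K' := fun x => Quotient.mk _ x
  have mk_surj : Function.Surjective mk := Quotient.exists_rep
  have hequiv : L.ElementarilyEquivalent K K' := by
    rw [FirstOrder.Language.elementarilyEquivalent_iff]
    intro ψ
    rw [FirstOrder.Language.Ultraproduct.sentence_realize]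
    simp
  obtain ⟨ψ, hψ⟩ := Set.definable_iff_exists_formula_sum.1 hP
  have hψ' : ∀ x, P x ↔ ψ.Realize (Sum.elim (fun a : (Set.univ : Set K) => (a : K)) x) := fun x =>
    Set.ext_iff.1 hψ x
  let q : α → K' := fun i => mk fun n => p n.down i
  let S : Set K' := {z | ψ.Realize (Sum.elim (fun a : (Set.univ : Set K) => mk fun _ => (a : K))
    (fun o : Option α => o.elim z q))}
  have hSmk : ∀ z : ι → K, mk z ∈ S ↔ ∀ᶠ n in U, P (fun o => o.elim (z n) (p n.down)) := by
    intro z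
    have := FirstOrder.Language.Ultraproduct.realize_formula_cast (u := U) (M := fun _ : ι => K) ψ
      (Sum.elim (fun a : (Set.univ : Set K) => fun _ => (a : K))
        (fun o : Option α => o.elim z (fun i n => p n.down i)))
    refine Iff.trans (Eq.to_iff ?_) (this.trans (eventually_congr ?_))
    · change ψ.Realize _ = ψ.Realize _
      congr 1
      funext i
      rcases i with a | (_ | i) <;> rfl
    · refine Eventually.of_forall fun n => ?_
      rw [hψ']
      refine Eq.to_iff ?_
      congr 1
      funext i
      rcases i with a | (_ | i) <;> rfl
  have hSdef : (Set.univ : Set K').Definable₁ L S := by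
    refine Set.definable_iff_exists_formula_sum.2 ⟨ψ.relabel (Sum.elim
      (fun a : (Set.univ : Set K) => Sum.inl ⟨mk fun _ => (a : K), Set.mem_univ _⟩)
      (fun o : Option α => o.elim (Sum.inr 0) fun i => Sum.inl ⟨q i, Set.mem_univ _⟩)), ?_⟩
    ext x
    change ψ.Realize _ ↔ (FirstOrder.Language.Formula.relabel _ ψ).Realize _
    rw [FirstOrder.Language.Formula.realize_relabel]
    refine Eq.to_iff ?_
    congr 1
    funext i
    rcases i with a | (_ | i) <;> rfl
  let _ : Ldiv.Structure K' := φ.reduct K'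
  obtain ⟨l, hl⟩ := exists_determinedStr (hmin K' hequiv S hSdef)
  -- the `Ldiv`-structure of the ultrapower, computed on representatives
  have hfun : ∀ {n : ℕ} (g : Ldiv.Functions n) (z : Fin n → K'),
      Structure.funMap g z = Structure.funMap (L := L) (φ.onFunction g) z := fun _ _ => rfl
  have hrel : ∀ {n : ℕ} (g : Ldiv.Relations n) (z : Fin n → K'),
      Structure.RelMap g z = Structure.RelMap (L := L) (φ.onRelation g) z := fun _ _ => rfl
  have hneg : ∀ y : ι → K, Structure.funMap (L := Ldiv) (n := 1) FirstOrder.ringFunc.neg ![mk y] =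
      mk fun n => - y n := by
    intro y
    have h := FirstOrder.Language.Ultraproduct.funMap_cast (u := U) (M := fun _ : ι => K)
      (φ.onFunction (n := 1) FirstOrder.ringFunc.neg) ![y]
    simp only [hexp.funMap_neg] at h
    refine (hfun (n := 1) FirstOrder.ringFunc.neg _).trans (Eq.trans ?_ h)
    congr 1
    funext i
    fin_cases i
    rfl
  have hsub : ∀ x y : ι → K, sSub (mk x) (mk y) = mk fun n => x n - y n := by
    intro x y
    have h := FirstOrder.Language.Ultraproduct.funMap_cast (u := U) (M := fun _ : ι => K)
      (φ.onFunction (n := 2) FirstOrder.ringFunc.add) ![x, fun n => - y n]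
    simp only [hexp.funMap_add] at h
    unfold sSub
    rw [hneg]
    refine ((hfun (n := 2) FirstOrder.ringFunc.add _).trans (Eq.trans ?_ h)).trans ?_
    · congr 1
      funext i
      fin_cases i <;> rfl
    · refine congrArg mk (funext fun n => ?_)
      exact (sub_eq_add_neg _ _).symm
  have hdiv : ∀ x y : ι → K, sDiv (mk x) (mk y) ↔ ∀ᶠ n in U, v (x n) ≤ v (y n) := by
    intro x y
    have h : Structure.RelMap (φ.onRelation (n := 2) DivRel.div)
        (fun i => mk ((![x, y] : Fin 2 → ι → K) i)) ↔
        ∀ᶠ n in U, Structure.RelMap (φ.onRelation (n := 2) DivRel.div)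
          fun i => (![x, y] : Fin 2 → ι → K) i n :=
      FirstOrder.Language.relMap_quotient_mk' (s := (U : Filter ι).productSetoid fun _ => K)
        (φ.onRelation (n := 2) DivRel.div) (![x, y] : Fin 2 → ι → K)
    simp only [hexp.relMap_div] at h
    refine Iff.trans (Eq.to_iff ?_) h
    refine (hrel (n := 2) DivRel.div _).trans ?_
    congr 1
    funext i
    fin_cases i <;> rfl
  let rep : K' → ι → K := Function.surjInv mk_surj
  have hrep : ∀ z, mk (rep z) = z := Function.surjInv_eq mk_surj
  let m : ι → List (K × WithTop Γ) := fun n => l.map fun c => (rep c.1 n, v (rep c.2 n))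
  -- otherwise counterexamples `x n`, `y n` would form a counterexample in the ultrapower
  have hev : ∀ᶠ n in U, Determined v (m n) {x | P (fun o => o.elim x (p n.down))} := by
    by_contra hnot
    rw [← Ultrafilter.eventually_not] at hnot
    have h1 : ∀ n : ι, ∃ x y : K, ¬ Determined v (m n) {x | P (fun o => o.elim x (p n.down))} →
        (∀ c ∈ m n, (c.2 ≤ v (x - c.1) ↔ c.2 ≤ v (y - c.1)) ∧
          (c.2 < v (x - c.1) ↔ c.2 < v (y - c.1))) ∧
        ¬ (P (fun o => o.elim x (p n.down)) ↔ P (fun o => o.elim y (p n.down))) := by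
      intro n
      by_cases h : Determined v (m n) {x | P (fun o => o.elim x (p n.down))}
      · exact ⟨0, 0, fun h' => absurd h h'⟩
      · unfold Determined at h
        push Not at h
        obtain ⟨x, y, h1, h2⟩ := h
        refine ⟨x, y, fun _ => ⟨h1, ?_⟩⟩
        simp only [Set.mem_ofPred_eq] at h2
        tauto
    choose x y hxy using h1
    have h2 := hnot.mono hxy
    have h3 : mk x ∈ S ↔ mk y ∈ S := by
      apply hl
      intro c hc
      have h4 := h2.mono fun n hn => hn.1 (rep c.1 n, v (rep c.2 n)) (List.mem_map.2 ⟨c, hc, rfl⟩)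
      rw [← hrep c.1, ← hrep c.2, hsub, hsub, hdiv, hdiv, hdiv, hdiv]
      refine ⟨eventually_congr (h4.mono fun n hn => hn.1),
        eventually_congr (h4.mono fun n hn => ?_)⟩
      simpa only [not_lt] using not_congr hn.2
    rw [hSmk, hSmk] at h3
    have h5 : (∀ᶠ n in U, P (fun o => o.elim (x n) (p n.down))) ∨
        ∀ᶠ n in U, ¬ P (fun o => o.elim (x n) (p n.down)) :=
      Ultrafilter.eventually_or.1 (Eventually.of_forall fun n => em _)
    rcases h5 with h5 | h5
    · obtain ⟨n, a, b, c⟩ := (h5.and ((h3.1 h5).and h2)).exists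
      exact c.2 (iff_of_true a b)
    · have h6 : ∀ᶠ n in U, ¬ P (fun o => o.elim (y n) (p n.down)) := by
        rw [Ultrafilter.eventually_not] at h5 ⊢
        exact fun h => h5 (h3.2 h)
      obtain ⟨n, a, b, c⟩ := (h5.and (h6.and h2)).exists
      exact c.2 (iff_of_false a b)
  have hlarge : ∀ᶠ n : ι in (U : Filter ι), l.length ≤ n.down := by
    have : {n : ι | ¬ l.length ≤ n.down}.Finite := by
      refine Set.Finite.preimage (f := ULift.down) ULift.down_injective.injOn
        (s := {n : ℕ | ¬ l.length ≤ n}) ?_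
      simpa using Set.finite_lt_nat l.length
    exact hyperfilter_le_cofinite this.compl_mem_cofinite |> fun h => by
      filter_upwards [h] with n hn
      simpa using hn
  obtain ⟨n, h1, h2⟩ := (hev.and hlarge).exists
  exact hp n.down (m n) (by simpa [m] using h2) h1

end UniformFiniteness

/-! ### Tame expansions -/

section Tame

variable (L : FirstOrder.Language.{u₁, u₂}) {K : Type w} [Field K] {Γ : Type w'} [AddCommGroup Γ]
  [LinearOrder Γ] [IsOrderedAddMonoid Γ] (v : AddValuation K (WithTop Γ)) [L.Structure K]

/-- What the argument uses of an expansion of a valued field: the valued field operations are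
definable, the members of a definable family of subsets of `K` are Boolean combinations of a
bounded number of balls, and the expansion is definably complete and eventually `ℚ`-linear. -/
structure TameExpansion : Prop where
  surj : Function.Surjective v
  add : DefFun L (fun x : Fin 2 → K => x 0 + x 1)
  mul : DefFun L (fun x : Fin 2 → K => x 0 * x 1)
  neg : DefFun L (fun x : Fin 1 → K => - x 0)
  div : DefPred L (fun x : Fin 2 → K => v (x 0) ≤ v (x 1))
  unif : ∀ {α : Type} (P : (Option α → K) → Prop), DefPred L P →
    ∃ N : ℕ, ∀ p : α → K, ∃ l : List (K × WithTop Γ), l.length ≤ N ∧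
      Determined v l {x | P (fun o => o.elim x p)}
  complete : DefinablyComplete L v
  lin : ∀ g : Γ → Γ, DefinableGammaFun L v g → EventuallyQLinear g

theorem tameExpansion_of_isCMinimal {L : FirstOrder.Language.{u₁, u₂}}
    {φ : FirstOrder.Language.LHom Ldiv L} {v : AddValuation K (WithTop Γ)} [L.Structure K]
    (hv : Function.Surjective v) (hexp : Expands φ v) (hmin : IsCMinimal φ K)
    (hcomplete : DefinablyComplete L v)
    (hlin : ∀ g : Γ → Γ, DefinableGammaFun L v g → EventuallyQLinear g) :
    TameExpansion L v where
  surj := hv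
  add := by
    have h : DefFun L (Structure.funMap (L := L) (M := K)
        (φ.onFunction (n := 2) FirstOrder.ringFunc.add)) :=
      (Set.DefinableFun.fun_symbol _).mono (Set.empty_subset _)
    rwa [funext hexp.funMap_add] at h
  mul := by
    have h : DefFun L (Structure.funMap (L := L) (M := K)
        (φ.onFunction (n := 2) FirstOrder.ringFunc.mul)) :=
      (Set.DefinableFun.fun_symbol _).mono (Set.empty_subset _)
    rwa [funext hexp.funMap_mul] at h
  neg := by
    have h : DefFun L (Structure.funMap (L := L) (M := K)
        (φ.onFunction (n := 1) FirstOrder.ringFunc.neg)) :=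
      (Set.DefinableFun.fun_symbol _).mono (Set.empty_subset _)
    rwa [funext hexp.funMap_neg] at h
  div := by
    have h : (∅ : Set K).Definable L {x : Fin 2 → K |
        Structure.RelMap (L := L) (φ.onRelation (n := 2) DivRel.div) x} :=
      Set.empty_definable_iff.2
        ⟨(φ.onRelation (n := 2) DivRel.div).formula FirstOrder.Language.Term.var, by
          ext x
          exact (FirstOrder.Language.Formula.realize_rel (R := φ.onRelation (n := 2) DivRel.div)
            (ts := FirstOrder.Language.Term.var) (v := x)).symm⟩
    exact DefPred.congr (P := _) (h.mono (Set.empty_subset _)) hexp.relMap_div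
  unif _ hP := exists_determined_of_defPred φ v hexp hmin hP
  complete := hcomplete
  lin := hlin

variable {L v} {α β : Type}

/-! ### Definability of the field operations and of the valuation -/

variable (T : TameExpansion L v)
include T

theorem TameExpansion.defAdd {g h : (α → K) → K} (hg : DefFun L g) (hh : DefFun L h) :
    DefFun L (fun x => g x + h x) := DefFun.fn₂ T.add hg hh

theorem TameExpansion.defMul {g h : (α → K) → K} (hg : DefFun L g) (hh : DefFun L h) :
    DefFun L (fun x => g x * h x) := DefFun.fn₂ T.mul hg hh

theorem TameExpansion.defSub {g h : (α → K) → K} (hg : DefFun L g) (hh : DefFun L h) :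
    DefFun L (fun x => g x - h x) := by
  simp only [sub_eq_add_neg]
  exact T.defAdd hg (DefFun.fn₁ T.neg hh)

theorem TameExpansion.defPow {g : (α → K) → K} (hg : DefFun L g) (n : ℕ) :
    DefFun L (fun x => g x ^ n) := by
  induction n with
  | zero =>
    simp only [pow_zero]
    exact DefFun.const 1
  | succ n ih =>
    simp only [pow_succ]
    exact T.defMul ih hg

theorem TameExpansion.defDiv {g h : (α → K) → K} (hg : DefFun L g) (hh : DefFun L h) :
    DefFun L (fun x => g x / h x) := by
  refine DefFun.fn₂ (f := fun a b => a / b) ?_ hg hh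
  rw [defFun_iff_graph]
  refine DefPred.congr (P := fun x => (x (some 1) = 0 ∧ x none = 0) ∨
    (¬ x (some 1) = 0 ∧ x none * x (some 1) = x (some 0))) ?_ fun x => ?_
  · exact ((DefPred.eq (DefFun.var _) (DefFun.const 0)).and
      (DefPred.eq (DefFun.var _) (DefFun.const 0))).or
      ((DefPred.eq (DefFun.var _) (DefFun.const 0)).not.and
        (DefPred.eq (T.defMul (DefFun.var _) (DefFun.var _)) (DefFun.var _)))
  · by_cases h : x (some 1) = 0
    · simp [h, eq_comm]
    · simp [h, div_eq_iff h, eq_comm]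

theorem TameExpansion.defLe {g h : (α → K) → K} (hg : DefFun L g) (hh : DefFun L h) :
    DefPred L (fun x => v (g x) ≤ v (h x)) :=
  DefPred.rel₂ (R := fun a b => v a ≤ v b) T.div hg hh

theorem TameExpansion.defLt {g h : (α → K) → K} (hg : DefFun L g) (hh : DefFun L h) :
    DefPred L (fun x => v (g x) < v (h x)) :=
  (T.defLe hh hg).not.congr fun _ => not_le

theorem TameExpansion.defValEq {g h : (α → K) → K} (hg : DefFun L g) (hh : DefFun L h) :
    DefPred L (fun x => v (g x) = v (h x)) :=
  ((T.defLe hg hh).and (T.defLe hh hg)).congr fun _ => le_antisymm_iff.symm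

end Tame

section Val

variable {L : FirstOrder.Language.{u₁, u₂}} {K : Type w} [Field K] {Γ : Type w'} [AddCommGroup Γ]
  [LinearOrder Γ] [IsOrderedAddMonoid Γ] {v : AddValuation K (WithTop Γ)} [L.Structure K]
  {α β : Type}

variable (L v) in
/-- The function `H` from tuples of elements of `K` to `Γ ∪ {+∞}` is definable (interpretable). -/
def DefVal (H : (α → K) → WithTop Γ) : Prop :=
  DefPred L (fun x : Option α → K => v (x none) = H (fun i => x (some i)))

theorem DefVal.subst [Finite β] {H : (β → K) → WithTop Γ} (hH : DefVal L v H)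
    {G : (α → K) → β → K} (hG : ∀ i, DefFun L (fun x => G x i)) :
    DefVal L v (fun x => H (G x)) := by
  refine DefPred.subst (β := Option β) (P := fun x => v (x none) = H (fun i => x (some i))) hH
    (G := fun (x : Option α → K) o => o.elim (x none) (fun i => G (fun j => x (some j)) i))
    fun i => ?_
  cases i with
  | none => exact DefFun.var none
  | some i =>
    exact Set.Definable.preimage_comp
      (fun o : Option α => (o.elim none (fun j => some (some j)) : Option (Option α))) (hG i)

theorem DefVal.fn₁ {H : K → WithTop Γ} (hH : DefVal L v (fun x : Fin 1 → K => H (x 0)))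
    {g : (α → K) → K} (hg : DefFun L g) : DefVal L v (fun x => H (g x)) :=
  DefVal.subst hH (G := fun x _ => g x) fun _ => hg

theorem TameExpansion.defVal (T : TameExpansion L v) {g : (α → K) → K} (hg : DefFun L g) :
    DefVal L v (fun x => v (g x)) :=
  T.defValEq (DefFun.var none) (Set.Definable.preimage_comp
      (fun o : Option α => (o.elim none (fun j => some (some j)) : Option (Option α))) hg)

theorem DefVal.le (T : TameExpansion L v) {G H : (α → K) → WithTop Γ} (hG : DefVal L v G)
    (hH : DefVal L v H) : DefPred L (fun x => G x ≤ H x) := by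
  refine DefPred.congr (P := fun x => ∃ y z, (v y = G x ∧ v z = H x) ∧ v y ≤ v z) ?_ fun x => ?_
  · refine DefPred.ex (DefPred.ex (DefPred.and (DefPred.and ?_ ?_) ?_))
    · exact Set.Definable.preimage_comp (fun o : Option α =>
        (o.elim (some none) (fun j => some (some j)) : Option (Option α))) hG
    · exact Set.Definable.preimage_comp (fun o : Option α =>
        (o.elim none (fun j => some (some j)) : Option (Option α))) hH
    · exact T.defLe (DefFun.var _) (DefFun.var _)
  · constructor
    · rintro ⟨y, z, ⟨h1, h2⟩, h3⟩
      rwa [h1, h2] at h3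
    · intro h
      obtain ⟨y, hy⟩ := T.surj (G x)
      obtain ⟨z, hz⟩ := T.surj (H x)
      exact ⟨y, z, ⟨hy, hz⟩, by rwa [hy, hz]⟩

theorem DefVal.eq (T : TameExpansion L v) {G H : (α → K) → WithTop Γ} (hG : DefVal L v G)
    (hH : DefVal L v H) : DefPred L (fun x => G x = H x) :=
  ((DefVal.le T hG hH).and (DefVal.le T hH hG)).congr fun _ => le_antisymm_iff.symm

end Val

/-! ### Elementary facts on valuations -/

section Valuation

variable {K : Type w} [Field K] {Γ : Type w'} [AddCommGroup Γ]
  [LinearOrder Γ] [IsOrderedAddMonoid Γ] (v : AddValuation K (WithTop Γ))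

theorem le_val_sub_trans {γ : WithTop Γ} {x y z : K} (h1 : γ ≤ v (x - y)) (h2 : γ ≤ v (y - z)) :
    γ ≤ v (x - z) := by
  have := v.map_le_add h1 h2
  rwa [sub_add_sub_cancel] at this

theorem lt_val_sub_trans {γ : WithTop Γ} {x y z : K} (h1 : γ < v (x - y)) (h2 : γ < v (y - z)) :
    γ < v (x - z) := by
  have := v.map_lt_add h1 h2
  rwa [sub_add_sub_cancel] at this

theorem val_sub_eq_of_lt {x y z : K} (h : v (x - z) < v (x - y)) : v (y - z) = v (x - z) := by
  have h1 : y - z = (x - z) - (x - y) := by ring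
  rw [h1]
  exact v.map_sub_eq_of_lt_left h

theorem exists_val_eq {v : AddValuation K (WithTop Γ)} (hv : Function.Surjective v) (γ : Γ) :
    ∃ t : K, t ≠ 0 ∧ v t = γ := by
  obtain ⟨t, ht⟩ := hv γ
  refine ⟨t, ?_, ht⟩
  rintro rfl
  rw [v.map_zero] at ht
  exact WithTop.top_ne_coe ht

theorem exists_coe_eq_val {t : K} (ht : t ≠ 0) : ∃ γ : Γ, v t = γ := by
  obtain ⟨γ, hγ⟩ := WithTop.ne_top_iff_exists.1 (v.ne_top_iff.2 ht)
  exact ⟨γ, hγ.symm⟩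

/-- The residue field is infinite: a closed ball is not covered by finitely many of its maximal
open subballs. -/
theorem exists_mem_closedBall_avoiding [IsAlgClosed K] {v : AddValuation K (WithTop Γ)}
    (hv : Function.Surjective v) (a : K) (γ : Γ) (F : Finset K) :
    ∃ y : K, γ ≤ v (y - a) ∧ ∀ t ∈ F, v (y - t) ≤ γ := by
  classical
  obtain ⟨c, hc, hcγ⟩ := exists_val_eq hv γ
  let F' : Finset K := (insert a F).filter fun t => γ ≤ v (t - a)
  have haF : a ∈ F' := by simp [F']
  -- a root `z` of `∏ (X - (t - a) / c) = 1` is integral and all the factors are units at `z`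
  let p : Polynomial K := ∏ t ∈ F', (Polynomial.X - Polynomial.C ((t - a) / c))
  have hdeg : p.natDegree = F'.card := by
    rw [Polynomial.natDegree_prod_of_monic _ _ fun t _ => Polynomial.monic_X_sub_C ((t - a) / c)]
    simp only [Polynomial.natDegree_X_sub_C, Finset.sum_const, smul_eq_mul, mul_one]
  have hcard : 0 < F'.card := Finset.card_pos.2 ⟨a, haF⟩
  obtain ⟨z, hz⟩ : ∃ z, p.eval z = 1 := by
    have : (p - Polynomial.C 1).degree ≠ 0 := by
      have h1 : 0 < p.degree := Polynomial.natDegree_pos_iff_degree_pos.1 (by omega)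
      rw [Polynomial.degree_sub_C h1]
      exact h1.ne'
    obtain ⟨z, hz⟩ := IsAlgClosed.exists_root _ this
    refine ⟨z, ?_⟩
    simpa [Polynomial.IsRoot, sub_eq_zero] using hz
  have hprod : ∑ t ∈ F', v (z - (t - a) / c) = 0 := by
    have h1 : ∀ s : Finset K, v (∏ t ∈ s, (z - (t - a) / c)) = ∑ t ∈ s, v (z - (t - a) / c) := by
      intro s
      induction s using Finset.induction_on with
      | empty => simp
      | insert b s hb ih => rw [Finset.prod_insert hb, Finset.sum_insert hb, v.map_mul, ih]
    rw [← h1, ← v.map_one, ← hz]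
    simp [p, Polynomial.eval_prod]
  have hint : ∀ t ∈ F', 0 ≤ v ((t - a) / c) := by
    intro t ht
    have h1 : γ ≤ v (t - a) := (Finset.mem_filter.1 ht).2
    have h2 : v (t - a) = v ((t - a) / c) + γ := by
      rw [← hcγ, ← v.map_mul, div_mul_cancel₀ _ hc]
    rw [h2] at h1
    by_contra! h3
    exact absurd h1 (not_le.2 (by
      simpa using WithTop.add_lt_add_right (WithTop.coe_ne_top (a := γ)) h3))
  have hz0 : 0 ≤ v z := by
    by_contra! h
    have h1 : ∀ t ∈ F', v (z - (t - a) / c) = v z := fun t ht =>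
      v.map_sub_eq_of_lt_left (h.trans_le (hint t ht))
    rw [Finset.sum_congr rfl h1, Finset.sum_const, ← v.map_pow] at hprod
    have h2 : v (z ^ F'.card) < 0 := by
      rw [v.map_pow]
      exact nsmul_neg h hcard.ne'
    exact h2.ne hprod
  have hnn : ∀ t ∈ F', 0 ≤ v (z - (t - a) / c) := fun t ht => v.map_le_sub hz0 (hint t ht)
  have hzero := (Finset.sum_eq_zero_iff_of_nonneg hnn).1 hprod
  refine ⟨a + c * z, ?_, fun t ht => ?_⟩
  · rw [add_sub_cancel_left, v.map_mul, hcγ]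
    exact le_add_of_nonneg_right hz0
  · by_cases h : γ ≤ v (t - a)
    · have h1 := hzero t (Finset.mem_filter.2 ⟨Finset.mem_insert_of_mem ht, h⟩)
      have h2 : a + c * z - t = c * (z - (t - a) / c) := by field_simp; ring
      rw [h2, v.map_mul, h1, hcγ, add_zero]
    · push Not at h
      have h1 : a + c * z - t = c * z - (t - a) := by ring
      have h2 : v (t - a) < v (c * z) := by
        rw [v.map_mul, hcγ]
        exact h.trans_le (le_add_of_nonneg_right hz0)
      rw [h1, v.map_sub_eq_of_lt_right h2]
      exact h.le

/-- The filter of punctured neighbourhoods of `0`. -/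
def zeroNE : Filter K where
  sets := {s | ∃ γ : Γ, ∀ t : K, t ≠ 0 → γ < v t → t ∈ s}
  univ_sets := ⟨0, fun _ _ _ => trivial⟩
  sets_of_superset := fun ⟨γ, h⟩ hst => ⟨γ, fun t h1 h2 => hst (h t h1 h2)⟩
  inter_sets := fun ⟨γ, h⟩ ⟨δ, h'⟩ => ⟨max γ δ, fun t h1 h2 =>
    ⟨h t h1 (lt_of_le_of_lt (WithTop.coe_le_coe.2 (le_max_left _ _)) h2),
      h' t h1 (lt_of_le_of_lt (WithTop.coe_le_coe.2 (le_max_right _ _)) h2)⟩⟩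

variable {v}

theorem eventually_zeroNE {P : K → Prop} :
    (∀ᶠ t in zeroNE v, P t) ↔ ∃ γ : Γ, ∀ t : K, t ≠ 0 → γ < v t → P t := Iff.rfl

theorem eventually_zeroNE_ne : ∀ᶠ t in zeroNE v, t ≠ 0 :=
  eventually_zeroNE.2 ⟨0, fun _ h _ => h⟩

theorem eventually_zeroNE_lt (γ : Γ) : ∀ᶠ t in zeroNE v, (γ : WithTop Γ) < v t :=
  eventually_zeroNE.2 ⟨γ, fun _ _ h => h⟩

theorem zeroNE_neBot [Nontrivial Γ] (hv : Function.Surjective v) : (zeroNE v).NeBot := by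
  rw [Filter.neBot_iff, Ne, ← Filter.eventually_false_iff_eq_bot, eventually_zeroNE]
  rintro ⟨γ, h⟩
  obtain ⟨δ, hδ⟩ := exists_gt γ
  obtain ⟨t, ht, htδ⟩ := exists_val_eq hv δ
  exact h t ht (htδ ▸ WithTop.coe_lt_coe.2 hδ)

end Valuation

/-! ### Definable subsets of the field -/

section Determined

variable {K : Type w} [Field K] {Γ : Type w'} [AddCommGroup Γ]
  [LinearOrder Γ] [IsOrderedAddMonoid Γ] {v : AddValuation K (WithTop Γ)}
  {l : List (K × WithTop Γ)} {S : Set K}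

/-- Off the residue classes of the centres, a Boolean combination of balls contains all of a
closed ball or nothing of it. -/
theorem Determined.mem_iff_of_avoids (h : Determined v l S) {a x y : K} {γ : Γ}
    (hx : γ ≤ v (x - a)) (hy : γ ≤ v (y - a)) (hxl : ∀ p ∈ l, v (x - p.1) ≤ γ)
    (hyl : ∀ p ∈ l, v (y - p.1) ≤ γ) : x ∈ S ↔ y ∈ S := by
  have hxy : γ ≤ v (x - y) := le_val_sub_trans v hx (v.map_sub_swap y a ▸ hy)
  have key : ∀ p ∈ l, v (x - p.1) = v (y - p.1) := by
    intro p hp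
    rcases (hxl p hp).lt_or_eq with h1 | h1
    · exact (val_sub_eq_of_lt v (h1.trans_le hxy)).symm
    · rcases (hyl p hp).lt_or_eq with h2 | h2
      · exact val_sub_eq_of_lt v (h2.trans_le (v.map_sub_swap x y ▸ hxy))
      · rw [h1, h2]
  exact h x y fun p hp => by rw [key p hp]; exact ⟨Iff.rfl, Iff.rfl⟩

theorem Determined.eventually_or [Nontrivial Γ] (hv : Function.Surjective v)
    (h : Determined v l S) (a : K) :
    (∀ᶠ t in zeroNE v, a + t ∈ S) ∨ ∀ᶠ t in zeroNE v, a + t ∉ S := by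
  have hne := zeroNE_neBot hv
  have key : ∀ p : K × WithTop Γ, ∃ A B : Prop, ∀ᶠ t in zeroNE v,
      (p.2 ≤ v (a + t - p.1) ↔ A) ∧ (p.2 < v (a + t - p.1) ↔ B) := by
    rintro ⟨c, ρ⟩
    by_cases hc : a = c
    · subst hc
      induction ρ using WithTop.recTopCoe with
      | top =>
        refine ⟨False, False, eventually_zeroNE_ne.mono fun t ht => ?_⟩
        simp [ht]
      | coe ρ =>
        refine ⟨True, True, (eventually_zeroNE_lt ρ).mono fun t ht => ?_⟩
        simp [ht, ht.le]
    · obtain ⟨γ, hγ⟩ := exists_coe_eq_val v (sub_ne_zero.2 hc)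
      refine ⟨ρ ≤ v (a - c), ρ < v (a - c), (eventually_zeroNE_lt γ).mono fun t ht => ?_⟩
      have h1 : v (a + t - c) = v (a - c) := by
        apply val_sub_eq_of_lt
        rwa [sub_add_cancel_left, v.map_neg, hγ]
      simp only [h1, and_self]
  choose A B hAB using key
  have hall : ∀ᶠ t in zeroNE v, ∀ p ∈ {p | p ∈ l},
      (p.2 ≤ v (a + t - p.1) ↔ A p) ∧ (p.2 < v (a + t - p.1) ↔ B p) :=
    (Filter.eventually_all_finite l.finite_toSet).2 fun p _ => hAB p
  obtain ⟨t₀, h₀⟩ := hall.exists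
  have hiff : ∀ᶠ t in zeroNE v, (a + t ∈ S ↔ a + t₀ ∈ S) := hall.mono fun t ht =>
    h _ _ fun p hp => ⟨(ht p hp).1.trans (h₀ p hp).1.symm, (ht p hp).2.trans (h₀ p hp).2.symm⟩
  by_cases hS : a + t₀ ∈ S
  · exact Or.inl (hiff.mono fun t ht => ht.2 hS)
  · exact Or.inr (hiff.mono fun t ht => fun h' => hS (ht.1 h'))

theorem Determined.finite_not_interior (h : Determined v l S) :
    {x | x ∈ S ∧ ¬ ∃ γ : Γ, ∀ y, γ < v (y - x) → y ∈ S}.Finite := by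
  refine Set.Finite.subset (l.map Prod.fst).finite_toSet ?_
  rintro x ⟨hx, hx'⟩
  by_contra hxl
  apply hx'
  have key : ∀ p ∈ {p | p ∈ l}, ∀ᶠ t in zeroNE v, v (x + t - p.1) = v (x - p.1) := by
    intro p hp
    have hne : x - p.1 ≠ 0 := by
      rw [sub_ne_zero]
      rintro rfl
      exact hxl (List.mem_map.2 ⟨p, hp, rfl⟩)
    obtain ⟨γ, hγ⟩ := exists_coe_eq_val v hne
    refine (eventually_zeroNE_lt γ).mono fun t ht => val_sub_eq_of_lt v ?_
    rwa [sub_add_cancel_left, v.map_neg, hγ]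
  obtain ⟨γ, hγ⟩ := eventually_zeroNE.1 ((Filter.eventually_all_finite l.finite_toSet).2 key)
  refine ⟨γ, fun y hy => ?_⟩
  by_cases hyx : y = x
  · rwa [hyx]
  · refine (h x y fun p hp => ?_).1 hx
    have := hγ (y - x) (sub_ne_zero.2 hyx) hy p hp
    rw [add_sub_cancel] at this
    rw [this]
    exact ⟨Iff.rfl, Iff.rfl⟩

end Determined

section Dichotomy

variable {L : FirstOrder.Language.{u₁, u₂}} {K : Type w} [Field K] {Γ : Type w'} [AddCommGroup Γ]
  [LinearOrder Γ] [IsOrderedAddMonoid Γ] {v : AddValuation K (WithTop Γ)} [L.Structure K]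
  (T : TameExpansion L v)
include T

theorem TameExpansion.exists_determined {P : K → Prop}
    (hP : DefPred L (fun x : Fin 1 → K => P (x 0))) : ∃ l, Determined v l {x | P x} := by
  have h : DefPred L (fun x : Option Empty → K => P (x none)) :=
    DefPred.rel₁ hP (DefFun.var none)
  obtain ⟨N, hN⟩ := T.unif _ h
  obtain ⟨l, -, hl⟩ := hN (fun e => e.elim)
  exact ⟨l, hl⟩

theorem TameExpansion.eventually_or_eventually_not [Nontrivial Γ] {P : K → Prop}
    (hP : DefPred L (fun x : Fin 1 → K => P (x 0))) :
    (∀ᶠ t in zeroNE v, P t) ∨ ∀ᶠ t in zeroNE v, ¬ P t := by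
  obtain ⟨l, hl⟩ := T.exists_determined hP
  simpa using hl.eventually_or T.surj 0

theorem TameExpansion.finite_not_interior {P : K → Prop}
    (hP : DefPred L (fun x : Fin 1 → K => P (x 0))) :
    {x | P x ∧ ¬ ∃ γ : Γ, ∀ y, γ < v (y - x) → P y}.Finite := by
  obtain ⟨l, hl⟩ := T.exists_determined hP
  exact hl.finite_not_interior

/-- An infinite definable set contains a ball. -/
theorem TameExpansion.exists_ball_of_infinite {P : K → Prop}
    (hP : DefPred L (fun x : Fin 1 → K => P (x 0))) (hinf : {x | P x}.Infinite) :
    ∃ (a : K) (γ : Γ), ∀ y, γ < v (y - a) → P y := by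
  by_contra! hcon
  refine hinf ((T.finite_not_interior hP).subset fun x hx => ⟨hx, ?_⟩)
  push Not
  exact hcon x

/-- A definable total preorder has, in every closed ball, one class that contains all but finitely
many of the residue classes of the ball. Otherwise there are infinitely many pairwise inequivalent
points in distinct residue classes; the initial segment of the preorder given by a point in the
middle of sufficiently many of them then separates too many residue classes for a Boolean
combination of few balls. -/
theorem TameExpansion.exists_generic_class [IsAlgClosed K] {R : K → K → Prop}
    (hR : DefPred L (fun x : Fin 2 → K => R (x 0) (x 1))) (htot : ∀ x y, R x y ∨ R y x)
    (htrans : ∀ x y z, R x y → R y z → R x z) (a : K) (γ : Γ) :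
    ∃ x, γ ≤ v (x - a) ∧ ∃ F : Finset K,
      ∀ y, γ ≤ v (y - a) → (∀ t ∈ F, v (y - t) ≤ γ) → R x y ∧ R y x := by
  classical
  have hC : DefPred L (fun z : Option (Fin 1) → K => R (z (some 0)) (z none) ∧
      R (z none) (z (some 0))) :=
    (DefPred.rel₂ hR (DefFun.var _) (DefFun.var _)).and
      (DefPred.rel₂ hR (DefFun.var _) (DefFun.var _))
  obtain ⟨_, hC⟩ := T.unif _ hC
  have hD : DefPred L (fun z : Option (Fin 1) → K => R (z none) (z (some 0))) :=
    DefPred.rel₂ hR (DefFun.var _) (DefFun.var _)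
  obtain ⟨N, hN⟩ := T.unif _ hD
  have hC' : ∀ x, ∃ F : Finset K, ∀ y z, γ ≤ v (y - a) → γ ≤ v (z - a) →
      (∀ t ∈ F, v (y - t) ≤ γ) → (∀ t ∈ F, v (z - t) ≤ γ) →
      ((R x y ∧ R y x) ↔ (R x z ∧ R z x)) := by
    intro x
    obtain ⟨l, -, hl⟩ := hC (fun _ => x)
    refine ⟨(l.map Prod.fst).toFinset, fun y z hy hz hyl hzl => ?_⟩
    exact hl.mem_iff_of_avoids hy hz (fun p hp => hyl _ (by simpa using ⟨_, hp⟩))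
      (fun p hp => hzl _ (by simpa using ⟨_, hp⟩))
  choose F hF using hC'
  have hD' : ∀ x, ∃ G : Finset K, G.card ≤ N ∧ ∀ y z, γ ≤ v (y - a) → γ ≤ v (z - a) →
      (∀ t ∈ G, v (y - t) ≤ γ) → (∀ t ∈ G, v (z - t) ≤ γ) → (R y x ↔ R z x) := by
    intro x
    obtain ⟨l, hlN, hl⟩ := hN (fun _ => x)
    refine ⟨(l.map Prod.fst).toFinset, ?_, fun y z hy hz hyl hzl => ?_⟩
    · exact (List.toFinset_card_le _).trans (by simpa using hlN)
    · exact hl.mem_iff_of_avoids hy hz (fun p hp => hyl _ (by simpa using ⟨_, hp⟩))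
        (fun p hp => hzl _ (by simpa using ⟨_, hp⟩))
  by_contra! hcon
  have hmiss : ∀ x, γ ≤ v (x - a) → ∀ y, γ ≤ v (y - a) → (∀ t ∈ F x, v (y - t) ≤ γ) →
      ¬ (R x y ∧ R y x) := by
    intro x hx y hy hyF hxy
    obtain ⟨z, hz, hzF, hxz⟩ := hcon x hx (F x)
    have := (hF x y z hy hz hyF hzF).1 hxy
    exact hxz this.1 this.2
  obtain ⟨f, hfa, hf⟩ := exists_seq_of_forall_finset_exists (fun x => γ ≤ v (x - a))
    (fun x y => v (y - x) ≤ γ ∧ ¬ (R x y ∧ R y x)) (fun s hs => by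
      obtain ⟨y, hy, hyF⟩ := exists_mem_closedBall_avoiding T.surj a γ (s ∪ s.biUnion F)
      exact ⟨y, hy, fun x hx => ⟨hyF x (Finset.mem_union_left _ hx), hmiss x (hs x hx) y hy
        fun t ht => hyF t (Finset.mem_union_right _ (Finset.mem_biUnion.2 ⟨x, hx, ht⟩))⟩⟩)
  have : IsTrans K R := ⟨htrans⟩
  have hrefl : ∀ x, R x x := fun x => (htot x x).elim id id
  -- among `N + 1` points in distinct residue classes, one avoids the at most `N` exceptional ones
  have hpigeon : ∀ (G : Finset K), G.card ≤ N → ∀ e : ℕ → ℕ, StrictMono e →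
      ∃ i ≤ N, ∀ t ∈ G, v (f (e i) - t) ≤ γ := by
    intro G hG e he
    by_contra! h
    choose! t htG ht using h
    have hmaps : ∀ i ∈ Finset.range (N + 1), t i ∈ G := fun i hi =>
      htG i (Nat.lt_succ_iff.1 (Finset.mem_range.1 hi))
    obtain ⟨i, hi, j, hj, hij, htij⟩ := Finset.exists_ne_map_eq_of_card_lt_of_maps_to
      (by simpa using Nat.lt_succ_of_le hG) hmaps
    have hi' := ht i (Nat.lt_succ_iff.1 (Finset.mem_range.1 hi))
    have hj' := ht j (Nat.lt_succ_iff.1 (Finset.mem_range.1 hj))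
    rw [← htij] at hj'
    rcases hij.lt_or_gt with hlt | hlt
    · exact absurd (lt_val_sub_trans v hj' (v.map_sub_swap (f (e i)) _ ▸ hi'))
        (not_lt.2 (hf _ _ (he hlt)).1)
    · exact absurd (lt_val_sub_trans v hi' (v.map_sub_swap (f (e j)) _ ▸ hj'))
        (not_lt.2 (hf _ _ (he hlt)).1)
  obtain ⟨g, hg⟩ := exists_increasing_or_nonincreasing_subseq R f
  -- the pivot of the initial segment lies in the first or in the second half of the sequence
  obtain ⟨k, hk⟩ : ∃ k, ∀ i j, i ≤ N →
      ¬ (R (f (g i)) (f (g k)) ↔ R (f (g (N + 1 + j))) (f (g k))) := by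
    rcases hg with hg | hg
    · refine ⟨N, fun i j hiN hij => ?_⟩
      have h1 : R (f (g i)) (f (g N)) := by
        rcases hiN.lt_or_eq with h | h
        · exact hg _ _ h
        · rw [h]; exact hrefl _
      exact (hf _ _ (g.strictMono (show N < N + 1 + j by omega))).2
        ⟨hg _ _ (by omega), hij.1 h1⟩
    · refine ⟨N + 1, fun i j hiN hij => hg i (N + 1) (by omega) (hij.2 ?_)⟩
      rcases Nat.eq_zero_or_pos j with h | h
      · rw [h]; exact hrefl _
      · exact (htot _ _).resolve_left (hg (N + 1) (N + 1 + j) (by omega))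
  obtain ⟨G, hGN, hG⟩ := hD' (f (g k))
  obtain ⟨i, hiN, hi⟩ := hpigeon G hGN g g.strictMono
  obtain ⟨j, hjN, hj⟩ := hpigeon G hGN (fun j => g (N + 1 + j))
    (fun m n hmn => g.strictMono (by omega))
  exact hk i j hiN (hG _ _ (hfa (g i)) (hfa (g (N + 1 + j))) hi hj)

end Dichotomy

/-! ### Asymptotics of definable functions at zero -/

section Asymptotics

variable {L : FirstOrder.Language.{u₁, u₂}} {K : Type w} [Field K] {Γ : Type w'} [AddCommGroup Γ]
  [LinearOrder Γ] [IsOrderedAddMonoid Γ] {v : AddValuation K (WithTop Γ)} [L.Structure K]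

theorem DefPred.eventually_zeroNE (T : TameExpansion L v) {α : Type} {P : (α → K) → K → Prop}
    (hP : DefPred L (fun x : Option α → K => P (fun i => x (some i)) (x none))) :
    DefPred L (fun x => ∀ᶠ t in zeroNE v, P x t) := by
  refine DefPred.congr (P := fun x => ∃ d : K, ¬ d = 0 ∧ ∀ t : K, ¬ t = 0 → v d < v t → P x t)
    ?_ fun x => ?_
  · refine DefPred.ex (DefPred.and (DefPred.eq (DefFun.var _) (DefFun.const 0)).not
      (DefPred.all (DefPred.imp (DefPred.eq (DefFun.var _) (DefFun.const 0)).not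
        (DefPred.imp (T.defLt (DefFun.var _) (DefFun.var _)) ?_))))
    exact Set.Definable.preimage_comp
      (fun o : Option α => (o.elim none (fun j => some (some j)) : Option (Option α))) hP
  · rw [CMin.eventually_zeroNE]
    constructor
    · rintro ⟨d, hd, h⟩
      obtain ⟨γ, hγ⟩ := exists_coe_eq_val v hd
      exact ⟨γ, fun t ht hγt => h t ht (hγ ▸ hγt)⟩
    · rintro ⟨γ, h⟩
      obtain ⟨d, hd, hγ⟩ := exists_val_eq T.surj γ
      exact ⟨d, hd, fun t ht hγt => h t ht (hγ ▸ hγt)⟩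

/-- Near `0`, a definable function to the value group depends only on the valuation. On each closed
ball around `0` the function has a generic value, and the points at which it takes this value form
a definable set: `t` belongs to it if and only if the level set of `t` meets all of its
translates. This set meets every annulus, hence contains a punctured neighbourhood of `0`. -/
theorem TameExpansion.eventually_eq_of_val_eq [IsAlgClosed K] [Nontrivial Γ]
    (T : TameExpansion L v) {H : K → WithTop Γ}
    (hH : DefVal L v (fun x : Fin 1 → K => H (x 0))) :
    ∀ᶠ t in zeroNE v, ∀ t', v t' = v t → H t' = H t := by
  classical
  let G : K → Prop := fun t => ∀ s, v t ≤ v s → ∃ w, v t ≤ v w ∧ H w = H t ∧ H (w + s) = H t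
  have hG : DefPred L (fun x : Fin 1 → K => G (x 0)) := by
    refine DefPred.all (DefPred.imp (T.defLe (DefFun.var _) (DefFun.var _))
      (DefPred.ex (DefPred.and (T.defLe (DefFun.var _) (DefFun.var _)) (DefPred.and ?_ ?_))))
    · exact DefVal.eq T (hH.fn₁ (DefFun.var _)) (hH.fn₁ (DefFun.var _))
    · exact DefVal.eq T (hH.fn₁ (T.defAdd (DefFun.var _) (DefFun.var _)))
        (hH.fn₁ (DefFun.var _))
  -- `H x` is the generic value of `H` on the closed ball of radius `γ`
  have key : ∀ γ : Γ, ∃ x : K, (∃ y, v y = γ ∧ G y) ∧ ∀ y, v y = γ → G y → H y = H x := by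
    intro γ
    obtain ⟨x, hx, F, hF⟩ := T.exists_generic_class (R := fun x y => H x ≤ H y)
      (DefVal.le T (hH.fn₁ (DefFun.var _)) (hH.fn₁ (DefFun.var _)))
      (fun x y => le_total _ _) (fun x y z => le_trans) 0 γ
    have hF' : ∀ y, γ ≤ v y → (∀ t ∈ F, v (y - t) ≤ γ) → H y = H x := fun y hy hyF =>
      have := hF y (by simpa using hy) hyF
      le_antisymm this.2 this.1
    refine ⟨x, ?_, ?_⟩
    · obtain ⟨y, hy, hyF⟩ := exists_mem_closedBall_avoiding T.surj 0 γ (insert 0 F)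
      have hyγ : v y = γ := le_antisymm (by simpa using hyF 0 (Finset.mem_insert_self _ _))
        (by simpa using hy)
      have hyx : H y = H x := hF' y hyγ.ge fun t ht => hyF t (Finset.mem_insert_of_mem ht)
      refine ⟨y, hyγ, fun s hs => ?_⟩
      obtain ⟨w, hw, hwF⟩ := exists_mem_closedBall_avoiding T.surj 0 γ
        (F ∪ F.image fun t => t - s)
      rw [sub_zero] at hw
      rw [hyγ] at hs
      rw [hyγ, hyx]
      refine ⟨w, hw, hF' w hw fun t ht => hwF t (Finset.mem_union_left _ ht),
        hF' _ (v.map_le_add hw hs) fun t ht => ?_⟩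
      have := hwF (t - s) (Finset.mem_union_right _ (Finset.mem_image_of_mem _ ht))
      rwa [show w - (t - s) = w + s - t by ring] at this
    · intro y hyγ hy
      by_contra hyx
      obtain ⟨s, hs, hsF⟩ := exists_mem_closedBall_avoiding T.surj 0 γ
        ((F ×ˢ F).image fun p => p.1 - p.2)
      rw [sub_zero] at hs
      obtain ⟨w, hw, h1, h2⟩ := hy s (hyγ ▸ hs)
      rw [hyγ] at hw
      obtain ⟨t', ht', hwt'⟩ : ∃ t ∈ F, γ < v (w - t) := by
        by_contra! h
        exact hyx (h1 ▸ hF' w hw h)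
      obtain ⟨t, ht, hwt⟩ : ∃ t ∈ F, γ < v (w + s - t) := by
        by_contra! h
        exact hyx (h2 ▸ hF' _ (v.map_le_add hw hs) h)
      have h3 := hsF (t - t') (Finset.mem_image.2 ⟨(t, t'), Finset.mem_product.2 ⟨ht, ht'⟩, rfl⟩)
      have h4 := v.map_lt_add hwt (v.map_sub_swap w t' ▸ hwt')
      rw [show w + s - t + (t' - w) = s - (t - t') by ring] at h4
      exact absurd h4 (not_lt.2 h3)
  have hev : ∀ᶠ t in zeroNE v, G t := by
    refine (T.eventually_or_eventually_not hG).resolve_right fun hnot => ?_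
    obtain ⟨δ, hδ⟩ := eventually_zeroNE.1 hnot
    obtain ⟨γ, hγ⟩ := exists_gt δ
    obtain ⟨x, ⟨y, hy, hyG⟩, -⟩ := key γ
    have hyne : y ≠ 0 := by
      rintro rfl
      exact WithTop.top_ne_coe (v.map_zero ▸ hy)
    exact hδ y hyne (hy ▸ WithTop.coe_lt_coe.2 hγ) hyG
  obtain ⟨δ, hδ⟩ := eventually_zeroNE.1 hev
  refine eventually_zeroNE.2 ⟨δ, fun t ht htδ t' ht' => ?_⟩
  obtain ⟨γ, hγ⟩ := exists_coe_eq_val v ht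
  obtain ⟨x, -, hx⟩ := key γ
  have ht'ne : t' ≠ 0 := by
    rintro rfl
    rw [v.map_zero, hγ] at ht'
    exact WithTop.top_ne_coe ht'
  rw [hx t hγ (hδ t ht htδ), hx t' (ht'.trans hγ) (hδ t' ht'ne (ht' ▸ htδ))]

theorem TameExpansion.eventually_linear [IsAlgClosed K] [Nontrivial Γ]
    (T : TameExpansion L v) {H : K → WithTop Γ}
    (hH : DefVal L v (fun x : Fin 1 → K => H (x 0))) (hfin : ∀ᶠ t in zeroNE v, H t ≠ ⊤) :
    ∃ (m : ℤ) (n : ℕ) (α : Γ), 0 < n ∧ ∀ᶠ t in zeroNE v, ∃ γ β : Γ, v t = γ ∧ H t = β ∧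
      n • (β - α) = m • γ := by
  classical
  obtain ⟨δ, hδ⟩ := eventually_zeroNE.1 (hfin.and (T.eventually_eq_of_val_eq hH))
  obtain ⟨d, hd, hdδ⟩ := exists_val_eq T.surj δ
  choose s hs0 hs using exists_val_eq T.surj
  -- the function induced by `H` on the value group, extended by `0` where `H` is not under control
  let g : Γ → Γ := fun γ => if δ < γ then (H (s γ)).untopD 0 else 0
  have hg : ∀ (t : K) (γ : Γ), v t = γ → δ < γ → H t = g γ := by
    intro t γ ht hγ
    have ht0 : t ≠ 0 := by
      rintro rfl
      exact WithTop.top_ne_coe (v.map_zero ▸ ht)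
    have h1 := hδ t ht0 (ht ▸ WithTop.coe_lt_coe.2 hγ)
    have h2 : H (s γ) = H t := h1.2 (s γ) ((hs γ).trans ht.symm)
    obtain ⟨β, hβ⟩ := WithTop.ne_top_iff_exists.1 h1.1
    simp only [g, if_pos hγ, h2, ← hβ, WithTop.untopD_coe]
  have hgdef : DefinableGammaFun L v g := by
    refine DefPred.congr (P := fun x : Fin 2 → K => ¬ x 0 = 0 ∧
      ((v d < v (x 0) ∧ v (x 1) = H (x 0)) ∨ (¬ v d < v (x 0) ∧ v (x 1) = v 1))) ?_ fun x => ?_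
    · refine DefPred.and (DefPred.eq (DefFun.var _) (DefFun.const 0)).not (DefPred.or
        (DefPred.and (T.defLt (DefFun.const d) (DefFun.var _)) ?_)
        (DefPred.and (T.defLt (DefFun.const d) (DefFun.var _)).not
          (T.defValEq (DefFun.var _) (DefFun.const 1))))
      exact DefVal.eq T (T.defVal (DefFun.var _)) (hH.fn₁ (DefFun.var _))
    · rw [hdδ]
      constructor
      · rintro ⟨hx0, hx⟩
        obtain ⟨γ, hγ⟩ := exists_coe_eq_val v hx0
        refine ⟨γ, hγ, ?_⟩
        rw [hγ, WithTop.coe_lt_coe] at hx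
        rcases hx with ⟨h1, h2⟩ | ⟨h1, h2⟩
        · rw [h2, hg _ _ hγ h1]
        · simp [g, if_neg h1, h2]
      · rintro ⟨γ, h1, h2⟩
        have hx0 : x 0 ≠ 0 := by
          intro h
          rw [h, v.map_zero] at h1
          exact WithTop.top_ne_coe h1
        refine ⟨hx0, ?_⟩
        rw [h1, WithTop.coe_lt_coe]
        by_cases hγ : δ < γ
        · exact Or.inl ⟨hγ, by rw [hg _ _ h1 hγ]; exact h2⟩
        · refine Or.inr ⟨hγ, h2.trans ?_⟩
          simp [g, if_neg hγ]
  obtain ⟨m, n, α, δ', hn, hlin⟩ := T.lin g hgdef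
  refine ⟨m, n, α, hn, ((eventually_zeroNE_ne (v := v)).and ((eventually_zeroNE_lt δ).and
    (eventually_zeroNE_lt δ'))).mono ?_⟩
  rintro t ⟨ht0, h1, h2⟩
  obtain ⟨γ, hγ⟩ := exists_coe_eq_val v ht0
  rw [hγ, WithTop.coe_lt_coe] at h1 h2
  exact ⟨γ, g γ, hγ, hg t γ hγ h1, hlin γ h2⟩

theorem exists_forall_lt_of_pos_slope {m : ℤ} {n : ℕ} (hm : 0 < m)
    (α ρ : Γ) : ∃ δ : Γ, ∀ γ β : Γ, δ < γ → n • (β - α) = m • γ → ρ < β := by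
  refine ⟨max 0 (n • (ρ - α)), fun γ β hγ h => ?_⟩
  by_contra! hβ
  have h0 : 0 < γ := (le_max_left _ _).trans_lt hγ
  have h1 : n • (β - α) ≤ n • (ρ - α) := nsmul_le_nsmul_right (sub_le_sub_right hβ α) n
  have h2 : γ ≤ m • γ := by
    simpa using zsmul_le_zsmul_left h0.le (show (1 : ℤ) ≤ m from hm)
  exact absurd ((le_max_right _ _).trans_lt hγ) (not_lt.2 (h2.trans (h ▸ h1)))

/-- Near `0`, a definable function to the value group has positive slope, or is constant, or tends
to `-∞`. -/
theorem TameExpansion.eventually_trichotomy [IsAlgClosed K] [Nontrivial Γ]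
    (T : TameExpansion L v) {H : K → WithTop Γ}
    (hH : DefVal L v (fun x : Fin 1 → K => H (x 0))) (hfin : ∀ᶠ t in zeroNE v, H t ≠ ⊤) :
    (∃ (m n : ℕ) (α : Γ), 0 < m ∧ 0 < n ∧ ∀ᶠ t in zeroNE v, ∃ γ β : Γ, v t = γ ∧ H t = β ∧
      n • (β - α) = m • γ) ∨
    (∃ α : Γ, ∀ᶠ t in zeroNE v, H t = α) ∨ ∀ ρ : Γ, ∀ᶠ t in zeroNE v, H t < ρ := by
  obtain ⟨m, n, α, hn, h⟩ := T.eventually_linear hH hfin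
  rcases lt_trichotomy m 0 with hm | rfl | hm
  · refine Or.inr (Or.inr fun ρ => ?_)
    obtain ⟨δ, hδ⟩ := exists_forall_lt_of_pos_slope (n := n) (neg_pos.2 hm) (-α) (-ρ)
    refine (h.and (eventually_zeroNE_lt δ)).mono ?_
    rintro t ⟨⟨γ, β, h1, h2, h3⟩, h4⟩
    rw [h1, WithTop.coe_lt_coe] at h4
    rw [h2, WithTop.coe_lt_coe]
    refine neg_lt_neg_iff.1 (hδ γ (-β) h4 ?_)
    rw [neg_smul, ← h3, ← smul_neg]
    congr 1
    abel
  · refine Or.inr (Or.inl ⟨α, h.mono ?_⟩)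
    rintro t ⟨γ, β, h1, h2, h3⟩
    rw [zero_smul] at h3
    rw [h2, sub_eq_zero.1 ((smul_eq_zero.1 h3).resolve_left hn.ne')]
  · refine Or.inl ⟨m.toNat, n, α, by omega, hn, h.mono ?_⟩
    rintro t ⟨γ, β, h1, h2, h3⟩
    refine ⟨γ, β, h1, h2, ?_⟩
    rw [h3, ← natCast_zsmul, Int.toNat_of_nonneg hm.le]

theorem eventually_lt_of_pos_slope {H : K → WithTop Γ} {m n : ℕ} {α : Γ} (hm : 0 < m)
    (h : ∀ᶠ t in zeroNE v, ∃ γ β : Γ, v t = γ ∧ H t = β ∧ n • (β - α) = m • γ) (ρ : Γ) :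
    ∀ᶠ t in zeroNE v, ρ < H t := by
  obtain ⟨δ, hδ⟩ := exists_forall_lt_of_pos_slope (m := m) (n := n) (by exact_mod_cast hm) α ρ
  refine (h.and (eventually_zeroNE_lt δ)).mono ?_
  rintro t ⟨⟨γ, β, h1, h2, h3⟩, h4⟩
  rw [h1, WithTop.coe_lt_coe] at h4
  rw [h2, WithTop.coe_lt_coe]
  exact hδ γ β h4 (by rw [h3, natCast_zsmul])

/-- A definable function whose valuation is constant near `0` has a limit at `0`.

Suppose not. Then for every `a` the valuation of `h t - a` has a constant value `E a` near `0`.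
If `E` is unbounded, the closed balls around `a` of radius `E a` have a common point by definable
completeness, on which `E` is maximal. If `E` is bounded, then `E (h t)` is constant near `0`, so
that `E` has a maximal value `β = E (h t)`. In the ball of radius `β` around `h t` the speed at
which `v (h t - c)` becomes equal to `β` is the same for almost all residue classes of `c`; this
is contradicted by `c = h t`. -/
theorem TameExpansion.exists_limit [IsAlgClosed K] [Nontrivial Γ] (T : TameExpansion L v)
    {h : K → K} (hh : DefFun L (fun x : Fin 1 → K => h (x 0))) {α₀ : Γ}
    (hα₀ : ∀ᶠ t in zeroNE v, v (h t) = α₀) :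
    ∃ c : K, ∀ γ : Γ, ∀ᶠ t in zeroNE v, γ < v (h t - c) := by
  have hne := zeroNE_neBot T.surj
  by_contra hlim
  have hcon : ∀ c, ∃ γ : Γ, ¬ ∀ᶠ t in zeroNE v, γ < v (h t - c) := fun c =>
    not_forall.1 (not_exists.1 hlim c)
  have hstep : ∀ a, ∃ E : Γ, ∀ᶠ t in zeroNE v, v (h t - a) = E := by
    intro a
    obtain ⟨γ, hγ⟩ := hcon a
    have hfin : ∀ᶠ t in zeroNE v, v (h t - a) ≠ ⊤ := by
      refine (T.eventually_or_eventually_not (P := fun t => v (h t - a) ≠ ⊤) ?_).resolve_right ?_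
      · refine DefPred.congr (P := fun x : Fin 1 → K => ¬ (h (x 0) = a)) (DefPred.eq
          (DefFun.fn₁ hh (DefFun.var _)) (DefFun.const a)).not fun x => ?_
        simp [sub_eq_zero]
      · intro h1
        refine hγ (h1.mono fun t ht => ?_)
        rw [not_ne_iff.1 ht]
        exact WithTop.coe_lt_top γ
    rcases T.eventually_trichotomy (H := fun t => v (h t - a)) (T.defVal (T.defSub
      (DefFun.fn₁ hh (DefFun.var _)) (DefFun.const a))) hfin with ⟨m, n, α, hm, hn, hlin⟩ | hc | hlt
    · exact absurd (eventually_lt_of_pos_slope hm hlin γ) hγ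
    · exact hc
    · exfalso
      obtain ⟨ρ, hρ1, hρ2⟩ : ∃ ρ : Γ, ρ ≤ α₀ ∧ (ρ : WithTop Γ) ≤ v a := by
        by_cases ha : a = 0
        · exact ⟨α₀, le_rfl, by simp [ha]⟩
        · obtain ⟨β, hβ⟩ := exists_coe_eq_val v ha
          exact ⟨min α₀ β, min_le_left _ _, by
            rw [hβ, WithTop.coe_le_coe]; exact min_le_right _ _⟩
      obtain ⟨t, h1, h2⟩ := ((hlt ρ).and hα₀).exists
      exact absurd h1 (not_lt.2 (v.map_le_sub (h2 ▸ WithTop.coe_le_coe.2 hρ1) hρ2))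
  choose E hE using hstep
  have hle : ∀ (ρ : WithTop Γ) c, (∀ᶠ t in zeroNE v, ρ ≤ v (h t - c)) → ρ ≤ E c := by
    intro ρ c hc
    obtain ⟨t, h1, h2⟩ := (hc.and (hE c)).exists
    rwa [h2] at h1
  have hEh : ∀ a, ∀ᶠ t in zeroNE v, E a ≤ E (h t) := by
    intro a
    refine (hE a).mono fun t ht => WithTop.coe_le_coe.1 (hle _ _ ((hE a).mono fun s hs => ?_))
    exact le_val_sub_trans v hs.ge (v.map_sub_swap (h t) a ▸ ht.ge)
  have hEdef : DefVal L v (fun x : Fin 1 → K => (E (x 0) : WithTop Γ)) := by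
    refine DefPred.congr (P := fun x : Option (Fin 1) → K =>
      ∀ᶠ t in zeroNE v, v (h t - x (some 0)) = v (x none)) (DefPred.eventually_zeroNE T ?_)
      fun x => ?_
    · exact T.defValEq (T.defSub (DefFun.fn₁ hh (DefFun.var _)) (DefFun.var _)) (DefFun.var _)
    · constructor
      · intro h1
        obtain ⟨t, h2, h3⟩ := (h1.and (hE (x (some 0)))).exists
        exact h2.symm.trans h3
      · intro h1
        exact (hE (x (some 0))).mono fun t ht => ht.trans h1.symm
  obtain ⟨M, hM⟩ : ∃ M : Γ, ∀ a, E a ≤ M := by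
    by_contra! hunb
    obtain ⟨x, hx⟩ := T.complete 1 Set.univ
      {p | (E (p (Sum.inl 0)) : WithTop Γ) ≤ v (p (Sum.inr ()) - p (Sum.inl 0))}
      Set.definable_univ
      (DefVal.le T (hEdef.fn₁ (H := fun a => (E a : WithTop Γ)) (DefFun.var _))
        (T.defVal (T.defSub (DefFun.var _) (DefFun.var _))))
      (fun p _ => Or.inl ⟨p 0, E (p 0), rfl⟩) (fun p _ q _ => by
        have key : ∀ a b : K, E a ≤ E b → ∀ x, (E b : WithTop Γ) ≤ v (x - b) →
            (E a : WithTop Γ) ≤ v (x - a) := by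
          intro a b hab x hx
          have hab' : (E a : WithTop Γ) ≤ E b := WithTop.coe_le_coe.2 hab
          obtain ⟨t, h1, h2⟩ := ((hE a).and (hE b)).exists
          refine le_val_sub_trans v (hab'.trans hx) (le_val_sub_trans v (y := h t) ?_ h1.ge)
          rw [v.map_sub_swap, h2]
          exact hab'
        rcases le_total (E (p 0)) (E (q 0)) with hpq | hpq
        · exact Or.inr (key _ _ hpq)
        · exact Or.inl (key _ _ hpq))
      (fun γ => by
        obtain ⟨a, ha⟩ := hunb γ
        exact ⟨fun _ => a, trivial, a, fun x hx => (WithTop.coe_le_coe.2 ha.le).trans hx⟩)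
    obtain ⟨a, ha⟩ := hunb (E x)
    have hxa : (E a : WithTop Γ) ≤ v (x - a) := hx (fun _ => a) trivial
    refine absurd ha (not_lt.2 (WithTop.coe_le_coe.1 (hle _ _ ((hE a).mono fun t ht => ?_))))
    exact le_val_sub_trans v ht.ge (v.map_sub_swap x a ▸ hxa)
  obtain ⟨β, hβ⟩ : ∃ β : Γ, ∀ᶠ t in zeroNE v, E (h t) = β := by
    rcases T.eventually_trichotomy (H := fun t => (E (h t) : WithTop Γ))
      (hEdef.fn₁ (H := fun a => (E a : WithTop Γ)) (DefFun.fn₁ hh (DefFun.var _)))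
      (Filter.Eventually.of_forall fun t => WithTop.coe_ne_top) with
      ⟨m, n, α, hm, hn, hlin⟩ | ⟨β, hβ⟩ | hlt
    · obtain ⟨t, ht⟩ := (eventually_lt_of_pos_slope hm hlin M).exists
      exact absurd (WithTop.coe_lt_coe.1 ht) (not_lt.2 (hM _))
    · exact ⟨β, hβ.mono fun t ht => WithTop.coe_injective ht⟩
    · obtain ⟨t, h1, h2⟩ := ((hlt (E 0)).and (hEh 0)).exists
      exact absurd (WithTop.coe_lt_coe.1 h1) (not_lt.2 h2)
  have hmax : ∀ a, E a ≤ β := by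
    intro a
    obtain ⟨t, h1, h2⟩ := ((hEh a).and hβ).exists
    rwa [h2] at h1
  obtain ⟨t₀, ht₀⟩ := hβ.exists
  have hball : ∀ c, (β : WithTop Γ) ≤ v (c - h t₀) → E c = β := by
    intro c hc
    refine le_antisymm (hmax c) (WithTop.coe_le_coe.1 (hle _ _ ((hE (h t₀)).mono fun t ht => ?_)))
    rw [ht₀] at ht
    exact le_val_sub_trans v ht.ge (v.map_sub_swap c (h t₀) ▸ hc)
  obtain ⟨b, -, hb⟩ := exists_val_eq T.surj β
  -- the function `t ↦ v (h t - c)` has reached its final value `β` beyond the radius `v d`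
  let A : K → K → Prop := fun c d => ∀ t, ¬ t = 0 → v d < v t → v (h t - c) = v b
  have hAmono : ∀ c d d', A c d → v d ≤ v d' → A c d' := fun c d d' hA hd t ht0 ht =>
    hA t ht0 (hd.trans_lt ht)
  have hAex : ∀ c, E c = β → ∃ d, d ≠ 0 ∧ A c d := by
    intro c hc
    obtain ⟨γ, hγ⟩ := eventually_zeroNE.1 (hE c)
    obtain ⟨d, hd0, hd⟩ := exists_val_eq T.surj γ
    exact ⟨d, hd0, fun t ht0 ht => by rw [hγ t ht0 (hd ▸ ht), hc, hb]⟩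
  obtain ⟨x, hx, F, hF⟩ := T.exists_generic_class (R := fun c c' => ∀ d, A c' d → A c d)
    (by
      refine DefPred.all (DefPred.imp ?_ ?_) <;>
      exact DefPred.all (DefPred.imp (DefPred.eq (DefFun.var _) (DefFun.const 0)).not
        (DefPred.imp (T.defLt (DefFun.var _) (DefFun.var _)) (T.defValEq
          (T.defSub (DefFun.fn₁ hh (DefFun.var _)) (DefFun.var _)) (DefFun.const b)))))
    (fun c c' => by
      by_contra! hnot
      obtain ⟨⟨d, h1, h2⟩, d', h3, h4⟩ := hnot
      rcases le_total (v d) (v d') with hd | hd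
      · exact h4 (hAmono _ _ _ h1 hd)
      · exact h2 (hAmono _ _ _ h3 hd))
    (fun c c' c'' h1 h2 d hd => h1 d (h2 d hd)) (h t₀) β
  obtain ⟨d, hd0, hd⟩ := hAex x (hball x hx)
  have hF' : ∀ᶠ t in zeroNE v, ∀ c ∈ F, (β : WithTop Γ) ≤ v (c - h t₀) → v (h t - c) = β := by
    refine (Filter.eventually_all_finset F).2 fun c _ => ?_
    by_cases hc : (β : WithTop Γ) ≤ v (c - h t₀)
    · exact (hE c).mono fun t ht _ => by rw [ht, hball c hc]
    · exact Filter.Eventually.of_forall fun t h' => absurd h' hc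
  have hd' : ∀ᶠ t in zeroNE v, v d < v t := by
    obtain ⟨δ, hδ⟩ := exists_coe_eq_val v hd0
    rw [hδ]
    exact eventually_zeroNE_lt δ
  obtain ⟨t, ⟨ht1, ht2⟩, ht3, ht4⟩ := ((hF'.and (hE (h t₀))).and
    (hd'.and eventually_zeroNE_ne)).exists
  rw [ht₀] at ht2
  have hRt := (hF (h t) ht2.ge fun c hc => by
    by_cases hc' : (β : WithTop Γ) ≤ v (c - h t₀)
    · exact (ht1 c hc hc').le
    · by_contra! hlt
      exact hc' (le_val_sub_trans v (v.map_sub_swap (h t) c ▸ hlt.le) ht2.ge)).2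
  have := hRt d hd t ht4 ht3
  rw [sub_self, v.map_zero, hb] at this
  exact WithTop.top_ne_coe this

end Asymptotics

/-! ### Functions that scale distances -/

section Scaling

variable {L : FirstOrder.Language.{u₁, u₂}} {K : Type w} [Field K] {Γ : Type w'} [AddCommGroup Γ]
  [LinearOrder Γ] [IsOrderedAddMonoid Γ] {v : AddValuation K (WithTop Γ)} [L.Structure K]

theorem eventually_zeroNE_comp {u : K → K} (hu0 : ∀ᶠ t in zeroNE v, u t ≠ 0)
    (hu : ∀ γ : Γ, ∀ᶠ t in zeroNE v, γ < v (u t)) {P : K → Prop} (hP : ∀ᶠ t in zeroNE v, P t) :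
    ∀ᶠ t in zeroNE v, P (u t) := by
  obtain ⟨γ, hγ⟩ := eventually_zeroNE.1 hP
  exact (hu0.and (hu γ)).mono fun t ht => hγ _ ht.1 ht.2

theorem val_limit_eq [Nontrivial Γ] (hv : Function.Surjective v) {q : K → K} {α : Γ} {c : K}
    (hq : ∀ᶠ t in zeroNE v, v (q t) = α) (hc : ∀ γ : Γ, ∀ᶠ t in zeroNE v, γ < v (q t - c)) :
    v c = α := by
  have := zeroNE_neBot hv
  obtain ⟨t, h1, h2⟩ := (hq.and (hc α)).exists
  have h3 := val_sub_eq_of_lt v (x := q t) (y := c) (z := 0) (by rwa [sub_zero, h1])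
  rwa [sub_zero, sub_zero, h1] at h3

theorem openBall_infinite [IsAlgClosed K] [Nontrivial Γ] (hv : Function.Surjective v) (a : K)
    (γ : Γ) : {x | γ < v (x - a)}.Infinite := by
  intro hfin
  obtain ⟨δ, hδ⟩ := exists_gt γ
  obtain ⟨y, hy, hyF⟩ := exists_mem_closedBall_avoiding hv a δ hfin.toFinset
  have := hyF y (by simpa using (WithTop.coe_lt_coe.2 hδ).trans_le hy)
  simp at this

variable (v) in
/-- On the open ball around `a` of radius `δ` the function `f` is injective, and the distance
`v (f y - f x)` is determined by `x` and by `v (y - x)`. -/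
def ScalesOn (f : K → K) (a : K) (δ : Γ) : Prop :=
  ∀ x, δ < v (x - a) → ∀ t, t ≠ 0 → δ < v t →
    f (x + t) ≠ f x ∧ ∀ t', v t' = v t → v (f (x + t') - f x) = v (f (x + t) - f x)

theorem TameExpansion.exists_scalesOn [IsAlgClosed K] [Nontrivial Γ] (T : TameExpansion L v)
    {f : K → K} (hf : DefFun L (fun x : Fin 1 → K => f (x 0))) {a : K} {γ : Γ}
    (hnc : ∀ x, γ < v (x - a) → ¬ ∃ δ : Γ, ∀ y, δ < v (y - x) → f y = f x) :
    ∃ (b : K) (δ : Γ), γ < v (b - a) ∧ γ ≤ δ ∧ ScalesOn v f b δ := by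
  -- the radius `v d` works at the point `x`
  let P : K → K → Prop := fun x d => ∀ t, ¬ t = 0 → v d < v t →
    ¬ f (x + t) = f x ∧ ∀ t', v t' = v t → v (f (x + t') - f x) = v (f (x + t) - f x)
  have hPmono : ∀ c d d', P c d → v d ≤ v d' → P c d' := fun c d d' hA hd t ht0 ht =>
    hA t ht0 (hd.trans_lt ht)
  have hPex : ∀ x, γ < v (x - a) → ∃ d, d ≠ 0 ∧ P x d := by
    intro x hx
    have h1 : ∀ᶠ t in zeroNE v, ¬ f (x + t) = f x := by
      refine (T.eventually_or_eventually_not (P := fun t => f (x + t) = f x) (DefPred.eq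
        (DefFun.fn₁ hf (T.defAdd (DefFun.const x) (DefFun.var _))) (DefFun.const _))).resolve_left
        fun h => hnc x hx ?_
      obtain ⟨δ, hδ⟩ := eventually_zeroNE.1 h
      refine ⟨δ, fun y hy => ?_⟩
      by_cases hyx : y = x
      · rw [hyx]
      · simpa using hδ (y - x) (sub_ne_zero.2 hyx) hy
    have h2 := T.eventually_eq_of_val_eq (H := fun t => v (f (x + t) - f x)) (T.defVal (T.defSub
      (DefFun.fn₁ hf (T.defAdd (DefFun.const x) (DefFun.var _))) (DefFun.const _)))
    obtain ⟨δ, hδ⟩ := eventually_zeroNE.1 (h1.and h2)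
    obtain ⟨d, hd0, hd⟩ := exists_val_eq T.surj δ
    exact ⟨d, hd0, fun t ht0 ht => hδ t ht0 (hd ▸ ht)⟩
  obtain ⟨γ₁, hγ₁⟩ := exists_gt γ
  have hγ₁' : (γ : WithTop Γ) < γ₁ := WithTop.coe_lt_coe.2 hγ₁
  obtain ⟨x, hx, F, hF⟩ := T.exists_generic_class (R := fun c c' => ∀ d, P c' d → P c d)
    (by
      have hdist : ∀ {α : Type} {g g' : (α → K) → K}, DefFun L g → DefFun L g' →
          DefFun L (fun x => f (g x + g' x) - f (g x)) := fun hg hg' =>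
        T.defSub (DefFun.fn₁ hf (T.defAdd hg hg')) (DefFun.fn₁ hf hg)
      refine DefPred.all (DefPred.imp ?_ ?_) <;>
      exact DefPred.all (DefPred.imp (DefPred.eq (DefFun.var _) (DefFun.const 0)).not
        (DefPred.imp (T.defLt (DefFun.var _) (DefFun.var _)) (DefPred.and (DefPred.eq
          (DefFun.fn₁ hf (T.defAdd (DefFun.var _) (DefFun.var _)))
          (DefFun.fn₁ hf (DefFun.var _))).not (DefPred.all (DefPred.imp
            (T.defValEq (DefFun.var _) (DefFun.var _))
            (T.defValEq (hdist (DefFun.var _) (DefFun.var _))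
              (hdist (DefFun.var _) (DefFun.var _)))))))))
    (fun c c' => by
      by_contra! hnot
      obtain ⟨⟨d, h1, h2⟩, d', h3, h4⟩ := hnot
      rcases le_total (v d) (v d') with hd | hd
      · exact h4 (hPmono _ _ _ h1 hd)
      · exact h2 (hPmono _ _ _ h3 hd))
    (fun c c' c'' h1 h2 d hd => h1 d (h2 d hd)) a γ₁
  obtain ⟨y, hy, hyF⟩ := exists_mem_closedBall_avoiding T.surj a γ₁ F
  obtain ⟨d, hd0, hd⟩ := hPex y (hγ₁'.trans_le hy)
  obtain ⟨ε, hε⟩ := exists_coe_eq_val v hd0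
  refine ⟨y, max γ₁ ε, hγ₁'.trans_le hy, hγ₁.le.trans (le_max_left _ _), fun z hz t ht0 ht => ?_⟩
  have hz1 : (γ₁ : WithTop Γ) < v (z - y) :=
    (WithTop.coe_le_coe.2 (le_max_left _ _)).trans_lt hz
  have hzF : ∀ t ∈ F, v (z - t) ≤ γ₁ := by
    intro t ht
    by_contra! h
    exact absurd (lt_val_sub_trans v (v.map_sub_swap z y ▸ hz1) h) (not_lt.2 (hyF t ht))
  have hPz : P z d :=
    (hF z (le_val_sub_trans v hz1.le hy) hzF).2 d ((hF y hy hyF).1 d hd)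
  exact hPz t ht0 (hε ▸ (WithTop.coe_le_coe.2 (le_max_right _ _)).trans_lt ht)

/-- The dilation factor of a definable function that scales distances is a positive integer. It is
not negative, since the images of closer points are at least as close, and not zero, since a bounded
difference `f (x + t) - f x` has a limit. If it is `m / n`, then `(f (x + t ^ n) - f x) / t ^ m` has
a nonzero limit, and replacing `t` by `η * t` for a primitive `n`-th root of unity `η` shows that
`η ^ m = 1`. -/
theorem TameExpansion.exists_dilation [IsAlgClosed K] [CharZero K] [Nontrivial Γ]
    (T : TameExpansion L v) {f : K → K} (hf : DefFun L (fun x : Fin 1 → K => f (x 0))) {a : K}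
    {δ : Γ} (hs : ScalesOn v f a δ) {x : K} (hx : δ < v (x - a)) :
    ∃ (r : ℕ) (α : Γ), 0 < r ∧ ∀ᶠ t in zeroNE v, ∃ γ : Γ, v t = γ ∧
      v (f (x + t) - f x) = ((r • γ + α : Γ) : WithTop Γ) := by
  classical
  have hne := zeroNE_neBot T.surj
  have hxt : DefFun L (fun t : Fin 1 → K => f (x + t 0) - f x) :=
    T.defSub (DefFun.fn₁ hf (T.defAdd (DefFun.const x) (DefFun.var _))) (DefFun.const _)
  have hδ : ∀ᶠ t in zeroNE v, t ≠ 0 ∧ δ < v t := eventually_zeroNE_ne.and (eventually_zeroNE_lt δ)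
  have hball : ∀ t, δ < v t → δ < v (x + t - a) := fun t ht => by
    rw [show x + t - a = t + (x - a) by ring]
    exact v.map_lt_add ht hx
  rcases T.eventually_trichotomy (H := fun t => v (f (x + t) - f x)) (T.defVal hxt)
    (hδ.mono fun t ht => by simpa [sub_eq_zero] using (hs x hx t ht.1 ht.2).1) with
    ⟨m, n, α, hm, hn, hlin⟩ | ⟨α, hα⟩ | hlt
  -- positive slope `m / n`
  · have hpow0 : ∀ᶠ t in zeroNE v, t ^ n ≠ 0 := eventually_zeroNE_ne.mono fun t => pow_ne_zero n
    have hpow : ∀ γ : Γ, ∀ᶠ t in zeroNE v, γ < v (t ^ n) := by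
      intro γ
      refine ((eventually_zeroNE_lt (max 0 γ)).and (eventually_zeroNE_ne (v := v))).mono
        fun t ht => ?_
      obtain ⟨τ, hτ⟩ := exists_coe_eq_val v ht.2
      have h1 := ht.1
      rw [hτ, WithTop.coe_lt_coe] at h1
      rw [v.map_pow, hτ, ← WithTop.coe_nsmul, WithTop.coe_lt_coe]
      exact ((le_max_right _ _).trans_lt h1).trans_le
        (by simpa using nsmul_le_nsmul_left ((le_max_left _ _).trans h1.le) hn)
    let q : K → K := fun t => (f (x + t ^ n) - f x) / t ^ m
    have hqdef : DefFun L (fun t : Fin 1 → K => q (t 0)) :=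
      T.defDiv (T.defSub (DefFun.fn₁ hf (T.defAdd (DefFun.const x) (T.defPow (DefFun.var _) n)))
        (DefFun.const _)) (T.defPow (DefFun.var _) m)
    have hqval : ∀ᶠ t in zeroNE v, v (q t) = α := by
      refine ((eventually_zeroNE_comp hpow0 hpow hlin).and eventually_zeroNE_ne).mono ?_
      rintro t ⟨⟨γ, β, h1, h2, h3⟩, ht0⟩
      obtain ⟨τ, hτ⟩ := exists_coe_eq_val v ht0
      rw [v.map_pow, hτ, ← WithTop.coe_nsmul, WithTop.coe_inj] at h1
      have h4 : β - α = m • τ := by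
        refine nsmul_right_injective hn.ne' ?_
        simp only
        rw [h3, ← h1, smul_comm]
      have h5 : v (q t) + ((m • τ : Γ) : WithTop Γ) = β := by
        rw [← h2, WithTop.coe_nsmul, ← hτ, ← v.map_pow, ← v.map_mul,
          div_mul_cancel₀ _ (pow_ne_zero m ht0)]
      have hq0 : q t ≠ 0 := by
        intro h
        rw [h, v.map_zero, top_add] at h5
        exact WithTop.top_ne_coe h5
      obtain ⟨ρ, hρ⟩ := exists_coe_eq_val v hq0
      rw [hρ, ← WithTop.coe_add, WithTop.coe_inj] at h5
      rw [hρ, WithTop.coe_inj]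
      rw [← h5, add_sub_assoc, add_comm, sub_add_eq_add_sub, sub_eq_iff_eq_add] at h4
      exact add_left_cancel (h4.trans (by abel))
    obtain ⟨c, hc⟩ := T.exists_limit hqdef hqval
    have : NeZero n := ⟨hn.ne'⟩
    have : NeZero (n : K) := ⟨Nat.cast_ne_zero.2 hn.ne'⟩
    obtain ⟨η, hη⟩ := HasEnoughRootsOfUnity.exists_primitiveRoot K n
    have hη0 : η ≠ 0 := hη.ne_zero hn.ne'
    have hvη : v η = 0 := by
      obtain ⟨ρ, hρ⟩ := exists_coe_eq_val v hη0
      have h1 := v.map_pow η n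
      rw [hη.pow_eq_one, v.map_one, hρ, ← WithTop.coe_nsmul, ← WithTop.coe_zero,
        WithTop.coe_inj] at h1
      rw [hρ, (smul_eq_zero.1 h1.symm).resolve_left hn.ne', WithTop.coe_zero]
    have hηm : η ^ m = 1 := by
      by_contra hηm
      obtain ⟨σ, hσ⟩ := exists_coe_eq_val v (sub_ne_zero.2 hηm)
      have hu0 : ∀ᶠ t in zeroNE v, η * t ≠ 0 := eventually_zeroNE_ne.mono fun t => mul_ne_zero hη0
      have hu : ∀ γ : Γ, ∀ᶠ t in zeroNE v, γ < v (η * t) := fun γ =>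
        (eventually_zeroNE_lt γ).mono fun t ht => by rwa [v.map_mul, hvη, zero_add]
      have h1 := hc (σ + α)
      have h2 := eventually_zeroNE_comp hu0 hu h1
      have h3 := eventually_zeroNE_comp hu0 hu hqval
      obtain ⟨t, ⟨ht1, ht2⟩, ht3, ht0⟩ := ((h1.and h2).and (h3.and eventually_zeroNE_ne)).exists
      have h4 : q t - q (η * t) = (η ^ m - 1) * q (η * t) := by
        simp only [q, mul_pow, hη.pow_eq_one, one_mul]
        field_simp
      have h5 := lt_val_sub_trans v ht1 (v.map_sub_swap c _ ▸ ht2)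
      rw [h4, v.map_mul, hσ, ht3, WithTop.coe_add] at h5
      exact lt_irrefl _ h5
    obtain ⟨r, rfl⟩ := (hη.pow_eq_one_iff_dvd m).1 hηm
    refine ⟨r, α, Nat.pos_of_mul_pos_left hm, hlin.mono ?_⟩
    rintro t ⟨γ, β, h1, h2, h3⟩
    refine ⟨γ, h1, ?_⟩
    have h4 : β - α = r • γ := by
      refine nsmul_right_injective hn.ne' ?_
      simp only
      rw [h3, mul_smul]
    rw [h2, ← h4, sub_add_cancel]
  -- slope `0`: the distances `v (f (x + t') - f (x + t))` would be constant and tend to `+∞`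
  · exfalso
    obtain ⟨c, hc⟩ := T.exists_limit hxt hα
    obtain ⟨ε, hε⟩ := eventually_zeroNE.1 ((hα.and (hc α)).and hδ)
    obtain ⟨γ, hγ⟩ := exists_gt ε
    have hγ' : (ε : WithTop Γ) < γ := WithTop.coe_lt_coe.2 hγ
    obtain ⟨t, ht0, ht⟩ := exists_val_eq T.surj γ
    obtain ⟨t', ht'1, ht'2⟩ := exists_mem_closedBall_avoiding T.surj 0 γ {0, t}
    simp only [Finset.mem_insert, Finset.mem_singleton, forall_eq_or_imp, forall_eq,
      sub_zero] at ht'1 ht'2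
    have ht'0 : t' ≠ 0 := by
      rintro rfl
      rw [v.map_zero] at ht'2
      exact absurd ht'2.1 (by simp)
    have h1 := hε t ht0 (ht ▸ hγ')
    have h2 := hε t' ht'0 (hγ'.trans_le ht'1)
    have h3 : v (t' - t) = v (-t) := by
      rw [v.map_neg, ht]
      exact le_antisymm ht'2.2 (v.map_le_sub ht'1 ht.ge)
    have h4 := (hs (x + t) (hball t h1.2.2) (-t) (neg_ne_zero.2 ht0)
      (by rw [v.map_neg]; exact h1.2.2)).2 (t' - t) h3
    rw [show x + t + (t' - t) = x + t' by ring, show x + t + -t = x by ring,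
      v.map_sub_swap (f x), h1.1.1] at h4
    have h5 := lt_val_sub_trans v h2.1.2 (v.map_sub_swap c _ ▸ h1.1.2)
    rw [show f (x + t') - f x - (f (x + t) - f x) = f (x + t') - f (x + t) by ring, h4] at h5
    exact lt_irrefl _ h5
  -- negative slope: with the point `x + t'` equidistant from `x` and from `x + t`, the ultrametric
  -- inequality bounds `v (f (x + t) - f x)` from below
  · exfalso
    obtain ⟨t', ht'0, ht'⟩ := hδ.exists
    obtain ⟨γ, hγ⟩ := exists_coe_eq_val v ht'0
    obtain ⟨β, hβ⟩ := exists_coe_eq_val v (sub_ne_zero.2 (hs x hx t' ht'0 ht').1)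
    obtain ⟨t, h1, h2⟩ := ((hlt β).and (eventually_zeroNE_lt γ)).exists
    have h3 : v (t - t') = v (-t') := by
      rw [v.map_neg]
      exact v.map_sub_eq_of_lt_right (hγ ▸ h2)
    have h4 := (hs (x + t') (hball t' ht') (-t') (neg_ne_zero.2 ht'0)
      (by rwa [v.map_neg])).2 (t - t') h3
    rw [show x + t' + (t - t') = x + t by ring, show x + t' + -t' = x by ring,
      v.map_sub_swap (f x), hβ] at h4
    exact absurd h1 (not_lt.2 (le_val_sub_trans v h4.ge hβ.ge))

end Scaling

/-! ### Derivatives -/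

section Derivative

variable {L : FirstOrder.Language.{u₁, u₂}} {K : Type w} [Field K] {Γ : Type w'} [AddCommGroup Γ]
  [LinearOrder Γ] [IsOrderedAddMonoid Γ] {v : AddValuation K (WithTop Γ)} [L.Structure K]

variable (v) in
/-- The function `f : K → K` has derivative `c` at the point `x`. -/
def HasDerivAtV (f : K → K) (x c : K) : Prop :=
  ∀ γ : Γ, ∀ᶠ t in zeroNE v, γ < v ((f (x + t) - f x) / t - c)

theorem eq_of_limits [Nontrivial Γ] (hv : Function.Surjective v) {q : K → K} {c c' : K}
    (hc : ∀ γ : Γ, ∀ᶠ t in zeroNE v, γ < v (q t - c))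
    (hc' : ∀ γ : Γ, ∀ᶠ t in zeroNE v, γ < v (q t - c')) : c = c' := by
  have := zeroNE_neBot hv
  by_contra hne
  obtain ⟨σ, hσ⟩ := exists_coe_eq_val v (sub_ne_zero.2 hne)
  obtain ⟨t, h1, h2⟩ := ((hc σ).and (hc' σ)).exists
  have h3 := lt_val_sub_trans v (v.map_sub_swap (q t) c ▸ h1) h2
  rw [hσ] at h3
  exact lt_irrefl _ h3

theorem hasDerivAtV_zero_of_eventually_eq {f : K → K} {x : K}
    (h : ∀ᶠ t in zeroNE v, f (x + t) = f x) : HasDerivAtV v f x 0 := fun γ =>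
  h.mono fun t ht => by simp [ht]

theorem forall_gamma_iff (hv : Function.Surjective v) {P : WithTop Γ → Prop} :
    (∀ γ : Γ, P γ) ↔ ∀ d : K, ¬ d = 0 → P (v d) := by
  constructor
  · intro h d hd
    obtain ⟨γ, hγ⟩ := exists_coe_eq_val v hd
    exact hγ ▸ h γ
  · intro h γ
    obtain ⟨d, hd, hγ⟩ := exists_val_eq hv γ
    exact hγ ▸ h d hd

theorem TameExpansion.defDeriv (T : TameExpansion L v) {f : K → K}
    (hf : DefFun L (fun x : Fin 1 → K => f (x 0))) :
    DefPred L (fun x : Fin 2 → K => HasDerivAtV v f (x 0) (x 1)) := by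
  refine DefPred.congr (P := fun x => ∀ d : K, ¬ d = 0 → ∀ᶠ t in zeroNE v,
    v d < v ((f (x 0 + t) - f (x 0)) / t - x 1)) ?_ fun x =>
    (forall_gamma_iff T.surj (P := fun γ => ∀ᶠ t in zeroNE v,
      γ < v ((f (x 0 + t) - f (x 0)) / t - x 1))).symm
  refine DefPred.all (DefPred.imp (DefPred.eq (DefFun.var _) (DefFun.const 0)).not
    (DefPred.eventually_zeroNE T (T.defLt (DefFun.var _) (T.defSub (T.defDiv (T.defSub
      (DefFun.fn₁ hf (T.defAdd (DefFun.var _) (DefFun.var _))) (DefFun.fn₁ hf (DefFun.var _)))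
      (DefFun.var _)) (DefFun.var _)))))

/-- A definable function that is injective on a ball has a definable inverse on some ball. -/
theorem TameExpansion.exists_inverse [IsAlgClosed K] [Nontrivial Γ]
    (T : TameExpansion L v) {f : K → K} (hf : DefFun L (fun x : Fin 1 → K => f (x 0)))
    {b : K} {δ : Γ} (hinj : ∀ x y, δ < v (x - b) → δ < v (y - b) → f x = f y → x = y) :
    ∃ (g : K → K) (w₀ : K) (ε : Γ), DefFun L (fun x : Fin 1 → K => g (x 0)) ∧
      ∀ w, ε < v (w - w₀) → δ < v (g w - b) ∧ f (g w) = w := by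
  classical
  obtain ⟨d, -, hd⟩ := exists_val_eq T.surj δ
  let R : K → K → Prop := fun w x => δ < v (x - b) ∧ f x = w
  have hR : DefPred L (fun z : Fin 2 → K => R (z 0) (z 1)) := by
    simp only [R, ← hd]
    exact (T.defLt (DefFun.const d) (T.defSub (DefFun.var _) (DefFun.const b))).and
      (DefPred.eq (DefFun.fn₁ hf (DefFun.var _)) (DefFun.var _))
  obtain ⟨w₀, ε, hw₀⟩ := T.exists_ball_of_infinite (P := fun w => ∃ x, R w x)
    (DefPred.ex (DefPred.rel₂ hR (DefFun.var _) (DefFun.var _)))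
    (by
      refine ((openBall_infinite T.surj b δ).image (f := f) ?_).mono ?_
      · exact fun x hx y hy hxy => hinj x y hx hy hxy
      · rintro _ ⟨x, hx, rfl⟩
        exact ⟨x, hx, rfl⟩)
  let g : K → K := fun w => if h : ∃ x, R w x then h.choose else 0
  refine ⟨g, w₀, ε, ?_, fun w hw => ?_⟩
  · rw [defFun_iff_graph]
    refine DefPred.congr (P := fun z : Option (Fin 1) → K => R (z (some 0)) (z none) ∨
      (¬ (∃ x, R (z (some 0)) x) ∧ z none = 0)) ?_ fun z => ?_
    · exact DefPred.or (DefPred.rel₂ hR (DefFun.var _) (DefFun.var _))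
        (DefPred.and (DefPred.not (DefPred.ex (DefPred.rel₂ hR (DefFun.var _) (DefFun.var _))))
          (DefPred.eq (DefFun.var _) (DefFun.const 0)))
    · by_cases h : ∃ x, R (z (some 0)) x
      · simp only [g, dif_pos h]
        constructor
        · rintro (h1 | h1)
          · exact hinj _ _ h.choose_spec.1 h1.1 (h.choose_spec.2.trans h1.2.symm)
          · exact absurd h h1.1
        · intro h1
          exact Or.inl (h1 ▸ h.choose_spec)
      · simp only [g, dif_neg h]
        constructor
        · rintro (h1 | h1)
          · exact absurd ⟨_, h1⟩ h
          · exact h1.2.symm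
        · intro h1
          exact Or.inr ⟨h, h1.symm⟩
  · simp only [g, dif_pos (hw₀ w hw)]
    exact (hw₀ w hw).choose_spec

/-- If the affine maps `γ ↦ r γ + α` and `γ ↦ s γ + β` are inverse to each other for large `γ`,
then their integral slopes are `1`. -/
theorem slope_eq_one {r s : ℕ} (hr : 0 < r) (hs : 0 < s) {α β δ : Γ} [Nontrivial Γ]
    (h : ∀ γ, δ < γ → γ = r • (s • γ + β) + α) : r = 1 := by
  by_contra hr1
  have h2 : 2 ≤ r * s := by
    have : 2 * 1 ≤ r * s := Nat.mul_le_mul (by omega) hs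
    omega
  obtain ⟨γ, hγ⟩ := exists_gt (max δ (max 0 (-(r • β + α))))
  have hγ1 := (le_max_left _ _).trans_lt hγ
  have hγ2 := (le_max_right _ _).trans_lt hγ
  have h6 : (2 : ℕ) • γ ≤ (r * s) • γ :=
    nsmul_le_nsmul_left ((le_max_left _ _).trans hγ2.le) h2
  have h7 : γ + (-(r • β + α)) = (r * s) • γ := by
    have h8 := h γ hγ1
    rw [smul_add, smul_smul, add_assoc] at h8
    rw [← sub_eq_add_neg, sub_eq_iff_eq_add]
    exact h8
  rw [two_smul, ← h7] at h6
  exact absurd ((le_max_right _ _).trans_lt hγ2) (not_lt.2 (le_of_add_le_add_left h6))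

/-- A definable function that is nowhere locally constant on a ball dilates distances by the factor
`1` at some point of the ball: on a smaller ball it scales distances, and so does its inverse on a
ball of the image, and the product of the two integral dilation factors is `1`. -/
theorem TameExpansion.exists_dilation_one [IsAlgClosed K] [CharZero K] [Nontrivial Γ]
    (T : TameExpansion L v) {f : K → K} (hf : DefFun L (fun x : Fin 1 → K => f (x 0)))
    {a : K} {γ₀ : Γ} (hnc : ∀ x, γ₀ < v (x - a) → ¬ ∃ δ : Γ, ∀ y, δ < v (y - x) → f y = f x) :
    ∃ (x : K) (α : Γ), γ₀ < v (x - a) ∧ ∀ᶠ t in zeroNE v, ∃ γ : Γ, v t = γ ∧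
      v (f (x + t) - f x) = ((γ + α : Γ) : WithTop Γ) := by
  obtain ⟨b, δ, hba, hγδ, hs⟩ := T.exists_scalesOn hf hnc
  have hsub : ∀ x, δ < v (x - b) → γ₀ < v (x - a) := fun x hx =>
    lt_val_sub_trans v ((WithTop.coe_le_coe.2 hγδ).trans_lt hx) hba
  obtain ⟨g, w₀, ε, hgdef, hg⟩ := T.exists_inverse hf (b := b) (δ := δ) (by
    intro x y hx hy hxy
    by_contra hne
    refine (hs x hx (y - x) (sub_ne_zero.2 (Ne.symm hne)) ?_).1 ?_
    · exact lt_val_sub_trans v hy (v.map_sub_swap x b ▸ hx)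
    · rw [add_sub_cancel, hxy])
  have hball : ∀ w t, ε < v (w - w₀) → ε < v t → ε < v (w + t - w₀) := by
    intro w t hw ht
    rw [show w + t - w₀ = t + (w - w₀) by ring]
    exact v.map_lt_add ht hw
  have hne := zeroNE_neBot T.surj
  obtain ⟨w₁, ε₁, hw₁, hε₁, hgs⟩ := T.exists_scalesOn hgdef (a := w₀) (γ := ε) (by
    rintro w hw ⟨η, hη⟩
    obtain ⟨t, ⟨h1, h2⟩, h3⟩ := (((eventually_zeroNE_lt (v := v) η).and
      (eventually_zeroNE_lt ε)).and eventually_zeroNE_ne).exists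
    have h4 : g (w + t) = g w := hη _ (by simpa using h1)
    have h6 := (hg _ (hball w t hw h2)).2
    rw [h4, (hg w hw).2] at h6
    exact h3 (by simpa using h6))
  have hw₁' : (ε₁ : WithTop Γ) < v (w₁ - w₁) := by
    rw [sub_self, v.map_zero]
    exact WithTop.coe_lt_top _
  obtain ⟨s, β, hs0, hsβ⟩ := T.exists_dilation hgdef hgs hw₁'
  obtain ⟨r, α, hr0, hrα⟩ := T.exists_dilation hf hs (hg w₁ hw₁).1
  have hg0 : ∀ᶠ t in zeroNE v, g (w₁ + t) - g w₁ ≠ 0 :=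
    (eventually_zeroNE_ne.and (eventually_zeroNE_lt ε₁)).mono fun t ht =>
      sub_ne_zero.2 (hgs w₁ hw₁' t ht.1 ht.2).1
  have hglarge : ∀ ρ : Γ, ∀ᶠ t in zeroNE v, ρ < v (g (w₁ + t) - g w₁) := by
    refine eventually_lt_of_pos_slope (n := 1) (α := β) hs0 (hsβ.mono ?_)
    rintro t ⟨γ, h1, h2⟩
    exact ⟨γ, _, h1, h2, by rw [one_smul, add_sub_cancel_right]⟩
  have hcomp : ∀ᶠ t in zeroNE v, ∃ γ : Γ, v t = γ ∧ γ = r • (s • γ + β) + α := by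
    refine ((hsβ.and (eventually_zeroNE_comp hg0 hglarge hrα)).and
      (eventually_zeroNE_lt ε)).mono ?_
    rintro t ⟨⟨⟨γ, h1, h2⟩, γ', h3, h4⟩, h5⟩
    rw [add_sub_cancel, (hg _ (hball w₁ t hw₁ h5)).2, (hg _ hw₁).2, add_sub_cancel_left, h1,
      WithTop.coe_inj] at h4
    rw [h3, WithTop.coe_inj] at h2
    exact ⟨γ, h1, by rw [← h2]; exact h4⟩
  obtain ⟨η, hη⟩ := eventually_zeroNE.1 hcomp
  obtain rfl : r = 1 := by
    refine slope_eq_one hr0 hs0 (δ := η) (α := α) (β := β) fun γ hγ => ?_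
    obtain ⟨t, ht0, ht⟩ := exists_val_eq T.surj γ
    obtain ⟨γ', h1, h2⟩ := hη t ht0 (ht ▸ WithTop.coe_lt_coe.2 hγ)
    rw [ht, WithTop.coe_inj] at h1
    rw [h1]
    exact h2
  simp only [one_smul] at hrα
  exact ⟨g w₁, α, hsub _ (hg w₁ hw₁).1, hrα⟩

theorem TameExpansion.exists_hasDerivAtV [IsAlgClosed K] [CharZero K] [Nontrivial Γ]
    (T : TameExpansion L v) {f : K → K} (hf : DefFun L (fun x : Fin 1 → K => f (x 0)))
    {a : K} {γ₀ : Γ} (hnc : ∀ x, γ₀ < v (x - a) → ¬ ∃ δ : Γ, ∀ y, δ < v (y - x) → f y = f x) :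
    ∃ x c, γ₀ < v (x - a) ∧ c ≠ 0 ∧ HasDerivAtV v f x c := by
  obtain ⟨x, α, hx, hα⟩ := T.exists_dilation_one hf hnc
  have hval : ∀ᶠ t in zeroNE v, v ((f (x + t) - f x) / t) = α := by
    refine (hα.and eventually_zeroNE_ne).mono ?_
    rintro t ⟨⟨γ, h1, h2⟩, h3⟩
    have h4 : v ((f (x + t) - f x) / t) + γ = α + γ := by
      rw [← h1, ← v.map_mul, div_mul_cancel₀ _ h3, h2, h1, WithTop.coe_add, add_comm]
    exact WithTop.add_right_cancel WithTop.coe_ne_top h4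
  obtain ⟨c, hc⟩ := T.exists_limit (h := fun t => (f (x + t) - f x) / t) (T.defDiv (T.defSub
    (DefFun.fn₁ hf (T.defAdd (DefFun.const x) (DefFun.var _))) (DefFun.const _)) (DefFun.var _))
    hval
  refine ⟨x, c, hx, ?_, hc⟩
  rintro rfl
  have := val_limit_eq T.surj hval hc
  rw [v.map_zero] at this
  exact WithTop.top_ne_coe this

/-- All but finitely many points are points of local constancy or points at which the derivative
exists and is not zero. -/
theorem TameExpansion.finite_exceptional [IsAlgClosed K] [CharZero K] [Nontrivial Γ]
    (T : TameExpansion L v) {f : K → K} (hf : DefFun L (fun x : Fin 1 → K => f (x 0))) :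
    {x | ¬ (∀ᶠ t in zeroNE v, f (x + t) = f x) ∧ ¬ ∃ c, ¬ c = 0 ∧ HasDerivAtV v f x c}.Finite := by
  by_contra hinf
  obtain ⟨a, γ, ha⟩ := T.exists_ball_of_infinite (P := fun x =>
    ¬ (∀ᶠ t in zeroNE v, f (x + t) = f x) ∧ ¬ ∃ c, ¬ c = 0 ∧ HasDerivAtV v f x c) (by
      refine DefPred.and (DefPred.not (DefPred.eventually_zeroNE T (DefPred.eq
        (DefFun.fn₁ hf (T.defAdd (DefFun.var _) (DefFun.var _)))
        (DefFun.fn₁ hf (DefFun.var _))))) (DefPred.not (DefPred.ex (DefPred.and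
          (DefPred.eq (DefFun.var _) (DefFun.const 0)).not ?_)))
      exact DefPred.rel₂ (R := HasDerivAtV v f) (T.defDeriv hf) (DefFun.var _) (DefFun.var _))
    hinf
  obtain ⟨x, c, hx, hc, hder⟩ := T.exists_hasDerivAtV hf (a := a) (γ₀ := γ) (by
    rintro x hx ⟨δ, hδ⟩
    exact (ha x hx).1 ((eventually_zeroNE_lt δ).mono fun t ht => hδ _ (by simpa using ht)))
  exact (ha x hx).2 ⟨c, hc, hder⟩

/-- A definable function is continuous at all but finitely many points. -/
theorem TameExpansion.finite_discontinuous [IsAlgClosed K] [CharZero K] [Nontrivial Γ]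
    (T : TameExpansion L v) {f : K → K} (hf : DefFun L (fun x : Fin 1 → K => f (x 0))) :
    {x | ¬ ∀ γ : Γ, ∀ᶠ t in zeroNE v, γ < v (f (x + t) - f x)}.Finite := by
  refine (T.finite_exceptional hf).subset fun x hx => ⟨fun h => hx fun γ => ?_, ?_⟩
  · exact h.mono fun t ht => by simp [ht]
  · rintro ⟨c, hc, hder⟩
    refine hx fun γ => ?_
    obtain ⟨σ, hσ⟩ := exists_coe_eq_val v hc
    refine (((hder σ).and (eventually_zeroNE_lt (γ - σ))).and eventually_zeroNE_ne).mono ?_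
    rintro t ⟨⟨h1, h2⟩, h3⟩
    have h4 : v ((f (x + t) - f x) / t) = σ := by
      rw [← hσ] at h1 ⊢
      exact v.map_eq_of_lt_sub h1
    rw [← div_mul_cancel₀ (f (x + t) - f x) h3, v.map_mul, h4]
    obtain ⟨τ, hτ⟩ := exists_coe_eq_val v h3
    rw [hτ, WithTop.coe_lt_coe] at h2
    rw [hτ, ← WithTop.coe_add, WithTop.coe_lt_coe]
    exact sub_lt_iff_lt_add'.1 h2

end Derivative

/-! ### Functions on a definable domain -/

section Domain

variable {L : FirstOrder.Language.{u₁, u₂}} {K : Type w} [Field K] {Γ : Type w'} [AddCommGroup Γ]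
  [LinearOrder Γ] [IsOrderedAddMonoid Γ] {v : AddValuation K (WithTop Γ)} [L.Structure K]
  {X : Set K} {f : K → K}

theorem hasDeriv_iff {x a : K} :
    HasDeriv v X f x a ↔ (¬ ∀ᶠ t in zeroNE v, ¬ x + t ∈ X) ∧
      ∀ γ : Γ, ∀ᶠ t in zeroNE v, x + t ∈ X → γ < v ((f (x + t) - f x) / t - a) := by
  refine and_congr ?_ (forall_congr' fun γ => ?_)
  · rw [eventually_zeroNE]
    push Not
    refine forall_congr' fun δ => ⟨?_, ?_⟩
    · rintro ⟨y, hy, hyx, h⟩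
      exact ⟨y - x, sub_ne_zero.2 hyx, h, by simpa using hy⟩
    · rintro ⟨t, ht, h, hx⟩
      exact ⟨x + t, hx, by simpa using ht, by simpa [openBall] using h⟩
  · rw [eventually_zeroNE]
    refine exists_congr fun δ => ⟨fun h t ht0 ht hx => ?_, fun h y hy hyx hδ => ?_⟩
    · simpa [openBall] using h (x + t) hx (by simpa using ht0) (by simpa [openBall] using ht)
    · simpa [openBall] using h (y - x) (sub_ne_zero.2 hyx) hδ (by simpa using hy)

theorem hasDeriv_of_hasDerivAtV [Nontrivial Γ] (hv : Function.Surjective v) {g : K → K} {x a : K}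
    (hX : ∀ᶠ t in zeroNE v, x + t ∈ X) (hx : x ∈ X) (hfg : ∀ y ∈ X, f y = g y)
    (hg : HasDerivAtV v g x a) : HasDeriv v X f x a := by
  have := zeroNE_neBot hv
  refine hasDeriv_iff.2 ⟨fun h => ?_, fun γ => (hg γ).mono fun t ht htX => ?_⟩
  · obtain ⟨t, h1, h2⟩ := (hX.and h).exists
    exact h2 h1
  · rwa [hfg x hx, hfg _ htX]

theorem HasDeriv.hasDerivAtV {g : K → K} {x a : K} (h : HasDeriv v X f x a)
    (hX : ∀ᶠ t in zeroNE v, x + t ∈ X) (hx : x ∈ X) (hfg : ∀ y ∈ X, f y = g y) :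
    HasDerivAtV v g x a := fun γ =>
  (((hasDeriv_iff.1 h).2 γ).and hX).mono fun t ht => by
    have := ht.1 ht.2
    rwa [hfg x hx, hfg _ ht.2] at this

theorem eventually_mem_iff_exists_ball {x : K} (hx : x ∈ X) :
    (∀ᶠ t in zeroNE v, x + t ∈ X) ↔ ∃ γ : Γ, openBall v x γ ⊆ X := by
  rw [eventually_zeroNE]
  refine exists_congr fun γ => ⟨fun h y hy => ?_, fun h t _ ht => h (by simpa [openBall] using ht)⟩
  by_cases hyx : y = x
  · rwa [hyx]
  · simpa using h (y - x) (sub_ne_zero.2 hyx) hy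

theorem openBall_subset_of_mem {x y : K} {γ : Γ} (hy : y ∈ openBall v x γ) :
    openBall v y γ ⊆ openBall v x γ := fun _ hz => lt_val_sub_trans v hz hy

omit [Field K] in
theorem DefinableFun.defPred_mem (hf : DefinableFun L X f) :
    DefPred L (fun x : Fin 1 → K => x 0 ∈ X) := by
  have h : DefPred L (fun x : Fin 2 → K => x 0 ∈ X ∧ x 1 = f (x 0)) := hf
  refine DefPred.congr (P := fun x : Fin 1 → K => ∃ z, x 0 ∈ X ∧ z = f (x 0)) (DefPred.ex
    (DefPred.rel₂ (R := fun x z => x ∈ X ∧ z = f x) h (DefFun.var _) (DefFun.var _))) fun x => ?_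
  simp

theorem DefinableFun.exists_extension (hf : DefinableFun L X f) :
    ∃ F : K → K, DefFun L (fun x : Fin 1 → K => F (x 0)) ∧ ∀ x ∈ X, f x = F x := by
  classical
  have h : DefPred L (fun x : Fin 2 → K => x 0 ∈ X ∧ x 1 = f (x 0)) := hf
  refine ⟨fun x => if x ∈ X then f x else 0, ?_, fun x hx => (if_pos hx).symm⟩
  rw [defFun_iff_graph]
  refine DefPred.congr (P := fun x : Option (Fin 1) → K =>
    (x (some 0) ∈ X ∧ x none = f (x (some 0))) ∨ (¬ x (some 0) ∈ X ∧ x none = 0))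
    (DefPred.or (DefPred.rel₂ (R := fun x z => x ∈ X ∧ z = f x) h (DefFun.var _) (DefFun.var _))
      (DefPred.and (DefPred.rel₁ (R := fun x => x ∈ X) hf.defPred_mem (DefFun.var _)).not
        (DefPred.eq (DefFun.var _) (DefFun.const 0)))) fun x => ?_
  by_cases hx : x (some 0) ∈ X <;> simp [hx, eq_comm]

variable (T : TameExpansion L v)
include T

theorem TameExpansion.definable_zeroDerivSet (hf : DefinableFun L X f) :
    (Set.univ : Set K).Definable₁ L (zeroDerivSet v X f) := by
  classical
  have hX := hf.defPred_mem
  obtain ⟨F, hF, hFX⟩ := hf.exists_extension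
  have hXt : DefPred L (fun z : Option (Fin 1) → K => z (some 0) + z none ∈ X) :=
    DefPred.rel₁ (R := fun x => x ∈ X) hX (T.defAdd (DefFun.var _) (DefFun.var _))
  refine DefPred.congr (P := fun x : Fin 1 → K => x 0 ∈ X ∧
    (¬ ∀ᶠ t in zeroNE v, ¬ x 0 + t ∈ X) ∧ ∀ d : K, ¬ d = 0 → ∀ᶠ t in zeroNE v,
      x 0 + t ∈ X → v d < v ((F (x 0 + t) - F (x 0)) / t)) ?_ fun x => ?_
  · refine DefPred.and hX (DefPred.and (DefPred.not (DefPred.eventually_zeroNE T hXt.not))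
      (DefPred.all (DefPred.imp (DefPred.eq (DefFun.var _) (DefFun.const 0)).not
        (DefPred.eventually_zeroNE T (DefPred.imp ?_ (T.defLt (DefFun.var _) (T.defDiv (T.defSub
          (DefFun.fn₁ hF (T.defAdd (DefFun.var _) (DefFun.var _))) (DefFun.fn₁ hF (DefFun.var _)))
          (DefFun.var _))))))))
    exact DefPred.rel₁ (R := fun x => x ∈ X) hX (T.defAdd (DefFun.var _) (DefFun.var _))
  · refine and_congr_right fun hx => ?_
    rw [hasDeriv_iff, ← forall_gamma_iff T.surj (P := fun γ => ∀ᶠ t in zeroNE v,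
      x 0 + t ∈ X → γ < v ((F (x 0 + t) - F (x 0)) / t))]
    refine and_congr_right fun _ => forall_congr' fun γ => Filter.eventually_congr
      (Filter.Eventually.of_forall fun t => imp_congr_right fun ht => ?_)
    rw [hFX _ hx, hFX _ ht, sub_zero]

variable [IsAlgClosed K] [CharZero K] [Nontrivial Γ]

theorem TameExpansion.zeroDerivSet_decomposition (hf : DefinableFun L X f) :
    ∃ F E : Set K, zeroDerivSet v X f = F ∪ E ∧ Disjoint F E ∧ F.Finite ∧
      LocallyConstantOn v f E := by
  classical
  obtain ⟨F, hF, hFX⟩ := hf.exists_extension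
  -- the points around which `f` is defined and constant
  let E : Set K := {x | ∃ γ : Γ, ∀ y ∈ openBall v x γ, y ∈ X ∧ f y = f x}
  have hself : ∀ (x : K) (γ : Γ), x ∈ openBall v x γ := fun x γ => by
    simp [openBall]
  have hE : E ⊆ zeroDerivSet v X f := by
    rintro x ⟨γ, hγ⟩
    have hx : x ∈ X := (hγ x (hself x γ)).1
    have hX : ∀ᶠ t in zeroNE v, x + t ∈ X :=
      (eventually_mem_iff_exists_ball hx).2 ⟨γ, fun y hy => (hγ y hy).1⟩
    refine ⟨hx, hasDeriv_of_hasDerivAtV T.surj hX hx (fun _ _ => rfl)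
      (hasDerivAtV_zero_of_eventually_eq ((eventually_zeroNE_lt γ).mono fun t ht => ?_))⟩
    exact (hγ (x + t) (by simpa [openBall] using ht)).2
  refine ⟨zeroDerivSet v X f \ E, E, (Set.sdiff_union_of_subset hE).symm, Set.disjoint_sdiff_left,
    ?_, ?_⟩
  · refine ((T.finite_not_interior hf.defPred_mem).union (T.finite_exceptional hF)).subset ?_
    rintro x ⟨⟨hx, hder⟩, hxE⟩
    by_contra hcon
    simp only [Set.mem_union, Set.mem_ofPred_eq, not_or, not_and, not_not] at hcon
    have hX : ∀ᶠ t in zeroNE v, x + t ∈ X := (eventually_mem_iff_exists_ball hx).2 (hcon.1 hx)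
    have hder' := hder.hasDerivAtV hX hx hFX
    by_cases hloc : ∀ᶠ t in zeroNE v, F (x + t) = F x
    · obtain ⟨γ, hγ⟩ := eventually_zeroNE.1 (hX.and hloc)
      refine hxE ⟨γ, fun y hy => ?_⟩
      by_cases hyx : y = x
      · exact ⟨hyx ▸ hx, by rw [hyx]⟩
      · have := hγ (y - x) (sub_ne_zero.2 hyx) hy
        rw [add_sub_cancel] at this
        exact ⟨this.1, by rw [hFX _ this.1, hFX _ hx, this.2]⟩
    · obtain ⟨c, hc, hcder⟩ := hcon.2 hloc
      exact hc (eq_of_limits T.surj hcder hder')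
  · rintro x ⟨γ, hγ⟩
    refine ⟨γ, fun y hy => ⟨γ, fun z hz => ?_⟩, fun y hy => (hγ y hy).2⟩
    have hz' := hγ z (openBall_subset_of_mem hy hz)
    exact ⟨hz'.1, hz'.2.trans (hγ y hy).2.symm⟩

theorem TameExpansion.exists_isC1On (hf : DefinableFun L X f) :
    ∃ U : Set K, U ⊆ X ∧ (X \ U).Finite ∧ IsC1On v f U := by
  classical
  obtain ⟨F, hF, hFX⟩ := hf.exists_extension
  let F' : K → K := fun x => if h : ∃ c, HasDerivAtV v F x c then h.choose else 0
  have hF'der : ∀ x, (∃ c, HasDerivAtV v F x c) → HasDerivAtV v F x (F' x) := by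
    intro x hx
    simp only [F', dif_pos hx]
    exact hx.choose_spec
  have hder : ∀ {α : Type} {g g' : (α → K) → K}, DefFun L g → DefFun L g' →
      DefPred L fun x => HasDerivAtV v F (g x) (g' x) := fun hg hg' =>
    DefPred.rel₂ (T.defDeriv hF) hg hg'
  have hF' : DefFun L (fun x : Fin 1 → K => F' (x 0)) := by
    rw [defFun_iff_graph]
    refine DefPred.congr (P := fun z : Option (Fin 1) → K => HasDerivAtV v F (z (some 0)) (z none) ∨
      (¬ (∃ c, HasDerivAtV v F (z (some 0)) c) ∧ z none = 0)) ?_ fun z => ?_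
    · exact DefPred.or (hder (DefFun.var _) (DefFun.var _)) (DefPred.and (DefPred.not
        (DefPred.ex (hder (DefFun.var _) (DefFun.var _))))
        (DefPred.eq (DefFun.var _) (DefFun.const 0)))
    · by_cases h : ∃ c, HasDerivAtV v F (z (some 0)) c
      · constructor
        · rintro (h1 | h1)
          · exact eq_of_limits T.surj (hF'der _ h) h1
          · exact absurd h h1.1
        · intro h1
          exact Or.inl (h1 ▸ hF'der _ h)
      · simp only [F', dif_neg h]
        constructor
        · rintro (h1 | h1)
          · exact absurd ⟨_, h1⟩ h
          · exact h1.2.symm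
        · intro h1
          exact Or.inr ⟨h, h1.symm⟩
  -- the exceptional points of `f`, and the points of discontinuity of its derivative
  let B : Set K := {x | ¬ (∀ᶠ t in zeroNE v, F (x + t) = F x) ∧
    ¬ ∃ c, ¬ c = 0 ∧ HasDerivAtV v F x c} ∪ {x | ¬ ∀ γ : Γ, ∀ᶠ t in zeroNE v,
      γ < v (F' (x + t) - F' x)}
  have hB : B.Finite := (T.finite_exceptional hF).union (T.finite_discontinuous hF')
  let U : Set K := {x | (x ∈ X ∧ ∃ γ : Γ, openBall v x γ ⊆ X) ∧ x ∉ B}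
  have hUX : U ⊆ X := fun x hx => hx.1.1
  have hUnhds : ∀ x ∈ U, ∀ᶠ t in zeroNE v, x + t ∈ U := by
    rintro x ⟨⟨hx, γ, hγ⟩, hxB⟩
    have h1 : ∀ᶠ t in zeroNE v, ∀ b ∈ B, x + t ≠ b := by
      refine (Filter.eventually_all_finite hB).2 fun b hb => ?_
      obtain ⟨σ, hσ⟩ := exists_coe_eq_val v (sub_ne_zero.2 (ne_of_mem_of_not_mem hb hxB))
      refine (eventually_zeroNE_lt σ).mono ?_
      rintro t ht rfl
      rw [add_sub_cancel_left] at hσ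
      exact absurd hσ ht.ne'
    refine (h1.and (eventually_zeroNE_lt γ)).mono fun t ht => ?_
    have hxt : x + t ∈ openBall v x γ := by simpa [openBall] using ht.2
    exact ⟨⟨hγ hxt, γ, (openBall_subset_of_mem hxt).trans hγ⟩, fun hb => ht.1 _ hb rfl⟩
  refine ⟨U, hUX, ?_, fun x hx => (eventually_mem_iff_exists_ball hx).1 (hUnhds x hx), F',
    fun x hx => ?_, fun x hx γ => ?_⟩
  · refine ((T.finite_not_interior hf.defPred_mem).union hB).subset ?_
    rintro x ⟨hx, hxU⟩
    by_contra hcon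
    rw [Set.mem_union, not_or] at hcon
    exact hxU ⟨⟨hx, not_not.1 fun h => hcon.1 ⟨hx, h⟩⟩, hcon.2⟩
  · refine hasDeriv_of_hasDerivAtV T.surj (hUnhds x hx) hx (fun y hy => hFX y (hUX hy))
      (hF'der x ?_)
    by_cases hloc : ∀ᶠ t in zeroNE v, F (x + t) = F x
    · exact ⟨0, hasDerivAtV_zero_of_eventually_eq hloc⟩
    · by_contra hno
      exact hx.2 (Or.inl ⟨hloc, fun ⟨c, _, hc⟩ => hno ⟨c, hc⟩⟩)
  · have hcont : ∀ γ : Γ, ∀ᶠ t in zeroNE v, γ < v (F' (x + t) - F' x) :=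
      not_not.1 fun h => hx.2 (Or.inr h)
    obtain ⟨δ, hδ⟩ := eventually_zeroNE.1 (hcont γ)
    refine ⟨δ, fun y _ hy => ?_⟩
    by_cases hyx : y = x
    · simp [hyx, openBall]
    · simpa [openBall] using hδ (y - x) (sub_ne_zero.2 hyx) hy

end Domain

end CMin

theorem mainTheorem10
    {L : FirstOrder.Language.{u₁, u₂}} (φ : FirstOrder.Language.LHom CMin.Ldiv L)
    {K : Type w} [Field K] [IsAlgClosed K] [CharZero K]
    {Γ : Type w'} [AddCommGroup Γ] [LinearOrder Γ] [IsOrderedAddMonoid Γ] [Nontrivial Γ]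
    (v : AddValuation K (WithTop Γ)) (hv : Function.Surjective v)
    [L.Structure K] (hexp : CMin.Expands φ v)
    (hmin : CMin.IsCMinimal φ K)
    (hcomplete : CMin.DefinablyComplete L v)
    (hlin : ∀ g : Γ → Γ, CMin.DefinableGammaFun L v g → CMin.EventuallyQLinear g)
    (X : Set K) (f : K → K) (hf : CMin.DefinableFun L X f) :
    (Set.univ : Set K).Definable₁ L (CMin.zeroDerivSet v X f) ∧
    (∃ F E : Set K, CMin.zeroDerivSet v X f = F ∪ E ∧ Disjoint F E ∧
      F.Finite ∧ CMin.LocallyConstantOn v f E) ∧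
    ∃ U : Set K, U ⊆ X ∧ (X \ U).Finite ∧ CMin.IsC1On v f U := by
  have T := CMin.tameExpansion_of_isCMinimal hv hexp hmin hcomplete hlin
  exact ⟨T.definable_zeroDerivSet hf, T.zeroDerivSet_decomposition hf, T.exists_isC1On hf⟩
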